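/- **Setting.** Let $n\ge 1$. A leader $a$ and a follower $b$ have budgets $x_a,x_b>0$ and values $v_{aj},v_{bj}>0$ for the battlefields $j\in[n]$, ordered so that $\frac{v_{a1}}{v_{b1}}\le\dots\le\frac{v_{an}}{v_{bn}}$. A strategy of player $i$ is a vector $\boldsymbol x_i=(x_{i1},\dots,x_{in})\ge 0$ with $\sum_j x_{ij}=x_i$; the utility of $i$ is $u_i=\sum_j \frac{x_{ij}}{x_{aj}+x_{bj}}v_{ij}$, where a battlefield in which nobody invests goes to the follower. An optimal commitment is a strategy $\boldsymbol x_a$ that maximizes $u_a(\boldsymbol x_a,\boldsymbol x_b)$, where $\boldsymbol x_b$ is the follower's best response to $\boldsymbol x_a$. For $K=\{1,\dots,k\}$, $1\le k\le n$, write $\overline K=[n]\setminus K$, $v_{iK}=\sum_{j\in K}v_{ij}$, $v_{i\overline K}=\sum_{j\in\overline K}v_{ij}$, $c_K=\sum_{j\in K}v_{aj}^2/v_{bj}$, $\varphi_1(\alpha)=B_1\alpha^2+B_2\alpha+B_3$, $\varphi_2(\alpha)=B_4\alpha^2+B_5\alpha+B_6$ with $$B_1=x_av_{bK}^2-2x_bv_{bK}v_{b\overline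 K},\quad B_2=4x_bv_{aK}v_{b\overline K}-2x_av_{aK}v_{bK},\quad B_3=x_av_{aK}^2-2x_bv_{b\overline K}c_K,$$ $$B_4=x_a^2v_{bK}^2-4x_b(x_a+x_b)v_{bK}v_{b\overline K},\quad B_5=8x_b(x_a+x_b)v_{aK}v_{b\overline K}-2x_a^2v_{aK}v_{bK},\quad B_6=x_a^2v_{aK}^2-4x_b(x_a+x_b)c_Kv_{b\overline K}.$$ The *leader's problem for $K$* is to maximize $$\hat u_K(\boldsymbol x_a)=\Big(\sum_{j\in K}\sqrt{\tfrac{x_{aj}}{v_{bj}}}\,v_{aj}\Big)\frac{\sum_{j\in K}\sqrt{x_{aj}v_{bj}}}{x_b+\sum_{j\in K}x_{aj}}$$ subject to $x_{aj}>0$ for all $j$, $\sum_j x_{aj}=x_a$, and $$x_{aj}=\frac{v_{bj}\,(x_b+\sum_{l\in K}x_{al})^2}{\big(\sum_{l\in K}\sqrt{x_{al}v_{bl}}\big)^2}\quad\text{for all } j\in\overline K.\qquad(*)$$ Call $K$ *uniform* if $v_{aj}/v_{bj}$ is constant on $K$. Call $K$ *feasible* if $B_4\ge 0$ (for uniform $K$)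 or $B_4>0$ (for non-uniform $K$). For feasible $K$ let $D_K=\{\alpha\in\mathbb R:\varphi_2(\alpha)\ge 0\}$, and let $f_K:D_K\to\mathbb R$ and $\boldsymbol x^{K,\alpha}$ be as follows; in each case $x^{K,\alpha}_j$ for $j\in\overline K$ is given by $(*)$. * *$K$ uniform:* with $$x_{aK}=\frac{x_av_{bK}-2x_bv_{b\overline K}+\sqrt{x_a^2v_{bK}^2-4x_ax_bv_{bK}v_{b\overline K}-4x_b^2v_{bK}v_{b\overline K}}}{2(v_{b\overline K}+v_{bK})},$$ $f_K(\alpha)=\frac{v_{aK}x_{aK}}{x_b+x_{aK}}$ (a constant), and $x^{K,\alpha}_j=x_{aK}\frac{v_{aj}}{v_{aK}}$ for $j\in K$. * *$K$ not uniform:* with $A_1(\alpha)=\sum_{j\in K}\big(\frac{v_{aj}}{\sqrt{v_{bj}}}-\alpha\sqrt{v_{bj}}\big)^2$, $$f_K(\alpha)=\frac{(c_K-\alpha v_{aK})(v_{aK}-\alpha v_{bK})}{\hat y(\alpha)x_b+A_1(\alpha)},\qquad x^{K,\alpha}_j=\frac{1}{\hat y(\alpha)}\Big(\frac{v_{aj}}{\sqrt{v_{bj}}}-\alpha\sqrt{v_{bj}}\Big)^2\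 \text{ for } j\in K,$$ where $\hat y(\alpha)=\frac{A_1(\alpha)}{x_a}$ if $K=[n]$, and $\hat y(\alpha)=\frac{\varphi_1(\alpha)-(v_{aK}-v_{bK}\alpha)\sqrt{\varphi_2(\alpha)}}{2x_b^2v_{b\overline K}}$ if $K\subsetneq[n]$. **Theorem.** There are two programs for a real random access machine (unit-cost arithmetic, square roots and comparisons), and a constant $C$, all independent of the game, such that for every $K\in\{\{1\},\{1,2\},\dots,[n]\}$: 1. The first program determines in at most $Cn$ steps whether $K$ is feasible and which of the cases ($K$ uniform; $K$ not uniform and $K=[n]$; $K$ not uniform and $K\subsetneq[n]$) applies, and computes the coefficients of $f_K$ and the end points of $D_K$. The second one computes $\boldsymbol x^{K,\alpha}$ from $\alpha\in D_K$ in at most $Cn$ steps. 2. If $K$ is feasible, then $D_K=(-\infty,\theta_1]\cup[\theta_2,\infty)$ with $\theta_1\le\theta_2$, where $\theta_{1,2}=\frac{-B_5\mp\sqrt{B_5^2-4B_4B_6}}{2B_4}$ if $B_4>0$ and $\theta_1=\theta_2=0$ if $B_4=0$; $f_K$ is continuous on $D_K$ and has a maximizer there; the solutions of the leader's problem for $K$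 are exactly the commitments $\boldsymbol x^{K,\alpha}$ with $\alpha$ a maximizer of $f_K$ over $D_K$ (the *candidates* for $K$); and $f_K(\alpha)=\hat u_K(\boldsymbol x^{K,\alpha})$ for these $\alpha$. 3. If $K=[n]$ is not uniform, the only maximizer is $\alpha=-\gamma$ with $\gamma=\big(\sum_{h}\frac{v_{ah}^2}{v_{bh}}\big/\sum_h v_{bh}\big)^{1/2}$, and the only candidate is $$x_{aj}=\frac{\big(\frac{v_{aj}}{\sqrt{v_{bj}}}+\gamma\sqrt{v_{bj}}\big)^2}{\sum_{l=1}^n\big(\frac{v_{al}}{\sqrt{v_{bl}}}+\gamma\sqrt{v_{bl}}\big)^2}\,x_a.$$ 4. If $\boldsymbol x_a$ is an optimal commitment and $K$ is the support of the follower's best response $\boldsymbol x_b$ to it, then $K$ is feasible, and for every maximizer $\alpha$ of $f_K$ over $D_K$ we have $\boldsymbol x_a=\boldsymbol x^{K,\alpha}$ and $u_a(\boldsymbol x_a,\boldsymbol x_b)=f_K(\alpha)+v_{a\overline K}$. Moreover, an optimal commitment exists; the support of the follower's best response to an optimal commitment is one of the sets $\{1\},\{1,2\},\dots,[n]$; and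 the optimal commitments are exactly those candidates (over all feasible $K$) that give the leader the highest utility $u_a$ against the follower's best response among all candidates. -/

import Mathlib

/-! ### The game -/

/-- A Lottery Colonel Blotto game on `n` battlefields between a leader `a` and a follower `b`, with
positive budgets `xa`, `xb` and positive battlefield values `va`, `vb`. -/
structure Game (n : ℕ) where
  xa : ℝ
  xb : ℝ
  va : Fin n → ℝ
  vb : Fin n → ℝ
  xa_pos : 0 < xa
  xb_pos : 0 < xb
  va_pos : ∀ j, 0 < va j
  vb_pos : ∀ j, 0 < vb j

namespace Game

variable {n : ℕ} (G : Game n)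

/-- The battlefields are ordered by nondecreasing ratio of the leader's to the follower's value. -/
def Sorted : Prop := ∀ i j : Fin n, i ≤ j → G.va i / G.vb i ≤ G.va j / G.vb j

/-- `x` is a pure strategy for a player with budget `b`. -/
def IsStrategy (b : ℝ) (x : Fin n → ℝ) : Prop := (∀ j, 0 ≤ x j) ∧ ∑ j, x j = b

/-- The leader's utility.  On a battlefield where nobody invests the leader gets `0 / 0 = 0`. -/
noncomputable def leaderUtility (x y : Fin n → ℝ) : ℝ :=
  ∑ j, x j / (x j + y j) * G.va j

open Classical in
/-- The follower's utility.  The follower wins a battlefield where nobody invests. -/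
noncomputable def followerUtility (x y : Fin n → ℝ) : ℝ :=
  ∑ j, if x j = 0 ∧ y j = 0 then G.vb j else y j / (x j + y j) * G.vb j

/-- `y` is a best response of the follower to the commitment `x`. -/
def IsBestResponse (x y : Fin n → ℝ) : Prop :=
  IsStrategy G.xb y ∧
    ∀ y', IsStrategy G.xb y' → G.followerUtility x y' ≤ G.followerUtility x y

/-- `x` is an optimal commitment of the leader: it maximizes the leader's utility against a best
responding follower. -/
def IsOptimalCommitment (x : Fin n → ℝ) : Prop :=
  IsStrategy G.xa x ∧ ∃ y, G.IsBestResponse x y ∧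
    ∀ x' y', IsStrategy G.xa x' → G.IsBestResponse x' y' →
      G.leaderUtility x' y' ≤ G.leaderUtility x y

/-! ### The leader's problem for a prescribed support `K` of the follower's best response -/

/-- The leader's utility from the battlefields in `K`, once the follower's best response with
support `K` has been substituted. -/
noncomputable def hatU (K : Finset (Fin n)) (x : Fin n → ℝ) : ℝ :=
  (∑ j ∈ K, √(x j / G.vb j) * G.va j) *
    ((∑ j ∈ K, √(x j * G.vb j)) / (G.xb + ∑ j ∈ K, x j))

/-- The feasible commitments: positive, exhausting the budget, and investing outside of `K` exactly
the threshold that keeps the follower away. -/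
def SupportFeasible (K : Finset (Fin n)) (x : Fin n → ℝ) : Prop :=
  (∀ j, 0 < x j) ∧ ∑ j, x j = G.xa ∧
    ∀ j, j ∉ K →
      x j = G.vb j * (G.xb + ∑ l ∈ K, x l) ^ 2 / (∑ l ∈ K, √(x l * G.vb l)) ^ 2

/-- `x` solves the leader's problem for the support `K`. -/
def SolvesSupport (K : Finset (Fin n)) (x : Fin n → ℝ) : Prop :=
  G.SupportFeasible K x ∧ ∀ x', G.SupportFeasible K x' → G.hatU K x' ≤ G.hatU K x

end Game

/-! ### The univariate problem -/

/-- The kinds of univariate problems: no solution for this `K`; equal value ratios in `K`; unequal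
value ratios and `K = [n]`; unequal value ratios and `K ≠ [n]`. -/
inductive Kind where
  | infeasible
  | uniform
  | full
  | proper

/-- The number by which a machine reports the kind of a problem. -/
def Kind.code : Kind → ℕ
  | .infeasible => 0
  | .uniform => 1
  | .full => 2
  | .proper => 3

/-- A univariate problem, given by its kind and fourteen real coefficients. -/
structure UniProblem where
  kind : Kind
  lo : ℝ
  hi : ℝ
  xa : ℝ
  xb : ℝ
  vaK : ℝ
  vbK : ℝ
  vbKc : ℝ
  cK : ℝ
  B1 : ℝ
  B2 : ℝ
  B3 : ℝ
  B4 : ℝ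
  B5 : ℝ
  B6 : ℝ

namespace UniProblem

/-- The real coefficients of the problem, in the order in which a machine reports them. -/
def coeffs (p : UniProblem) : List ℝ :=
  [p.lo, p.hi, p.xa, p.xb, p.vaK, p.vbK, p.vbKc, p.cK, p.B1, p.B2, p.B3, p.B4, p.B5, p.B6]

def phi1 (p : UniProblem) (α : ℝ) : ℝ := p.B1 * α ^ 2 + p.B2 * α + p.B3

def phi2 (p : UniProblem) (α : ℝ) : ℝ := p.B4 * α ^ 2 + p.B5 * α + p.B6

/-- `∑ j ∈ K, (va j / √(vb j) - α * √(vb j)) ^ 2`, expanded in powers of `α`. -/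
def A1 (p : UniProblem) (α : ℝ) : ℝ := p.cK - 2 * α * p.vaK + α ^ 2 * p.vbK

/-- The leader's total investment in `K` when the value ratios in `K` are equal. -/
noncomputable def uniformBudget (p : UniProblem) : ℝ :=
  (p.xa * p.vbK - 2 * p.xb * p.vbKc +
      √(p.xa ^ 2 * p.vbK ^ 2 - 4 * p.xa * p.xb * p.vbK * p.vbKc
          - 4 * p.xb ^ 2 * p.vbK * p.vbKc)) /
    (2 * (p.vbKc + p.vbK))

/-- The squared multiplier `β ^ 2` as a function of `α` (for unequal value ratios in `K`). -/
noncomputable def yHat (p : UniProblem) (α : ℝ) : ℝ :=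
  match p.kind with
  | .full => p.A1 α / p.xa
  | _ => (p.phi1 α - (p.vaK - p.vbK * α) * √(p.phi2 α)) / (2 * p.xb ^ 2 * p.vbKc)

/-- The objective function.  For equal value ratios in `K` it does not depend on `α`. -/
noncomputable def objective (p : UniProblem) (α : ℝ) : ℝ :=
  match p.kind with
  | .uniform => p.vaK * p.uniformBudget / (p.xb + p.uniformBudget)
  | _ => (p.cK - α * p.vaK) * (p.vaK - α * p.vbK) / (p.yHat α * p.xb + p.A1 α)

/-- The domain over which the objective is maximized. -/
def domain (p : UniProblem) : Set ℝ := {α | p.kind ≠ .infeasible ∧ 0 ≤ p.phi2 α}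

/-- The set of solutions of the univariate problem. -/
def solutions (p : UniProblem) : Set ℝ :=
  {α | α ∈ p.domain ∧ ∀ α' ∈ p.domain, p.objective α' ≤ p.objective α}

end UniProblem

namespace Game

variable {n : ℕ} (G : Game n)

/-- All battlefields in `K` have the same ratio of the leader's to the follower's value. -/
def UniformOn (K : Finset (Fin n)) : Prop :=
  ∀ j ∈ K, ∀ h ∈ K, G.va j / G.vb j = G.va h / G.vb h

open Classical in
/-- The kind of the problem for `K`, where `B4` is the leading coefficient of `phi2`. -/
noncomputable def problemKind (K : Finset (Fin n)) (B4 : ℝ) : Kind :=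
  if G.UniformOn K then (if 0 ≤ B4 then .uniform else .infeasible)
  else if B4 ≤ 0 then .infeasible
  else if K = Finset.univ then .full
  else .proper

/-- The univariate problem for the support `K`. -/
noncomputable def problem (K : Finset (Fin n)) : UniProblem :=
  let vaK := ∑ j ∈ K, G.va j
  let vbK := ∑ j ∈ K, G.vb j
  let vbKc := ∑ j ∈ Kᶜ, G.vb j
  let cK := ∑ j ∈ K, G.va j ^ 2 / G.vb j
  let B4 := G.xa ^ 2 * vbK ^ 2 - 4 * G.xb * (G.xa + G.xb) * vbK * vbKc
  let B5 := 8 * G.xb * (G.xa + G.xb) * vaK * vbKc - 2 * G.xa ^ 2 * vaK * vbK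
  let B6 := G.xa ^ 2 * vaK ^ 2 - 4 * G.xb * (G.xa + G.xb) * cK * vbKc
  { kind := G.problemKind K B4
    lo := (-B5 - √(B5 ^ 2 - 4 * B4 * B6)) / (2 * B4)
    hi := (-B5 + √(B5 ^ 2 - 4 * B4 * B6)) / (2 * B4)
    xa := G.xa
    xb := G.xb
    vaK := vaK
    vbK := vbK
    vbKc := vbKc
    cK := cK
    B1 := G.xa * vbK ^ 2 - 2 * G.xb * vbK * vbKc
    B2 := 4 * G.xb * vaK * vbKc - 2 * G.xa * vaK * vbK
    B3 := G.xa * vaK ^ 2 - 2 * G.xb * vbKc * cK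
    B4 := B4
    B5 := B5
    B6 := B6 }

/-- The leader's investment in a battlefield `j ∈ K` that belongs to the parameter `α`. -/
noncomputable def insideInvestment (K : Finset (Fin n)) (α : ℝ) (j : Fin n) : ℝ :=
  let p := G.problem K
  match p.kind with
  | .uniform => p.uniformBudget * (G.va j / p.vaK)
  | .full =>
      (G.va j / √(G.vb j) - α * √(G.vb j)) ^ 2 * G.xa /
        ∑ l, (G.va l / √(G.vb l) - α * √(G.vb l)) ^ 2
  | _ =>
      2 * G.xb ^ 2 * p.vbKc * (G.va j / √(G.vb j) - α * √(G.vb j)) ^ 2 /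
        (p.phi1 α - (p.vaK - p.vbK * α) * √(p.phi2 α))

open Classical in
/-- The leader's commitment that belongs to the parameter `α`. -/
noncomputable def commitment (K : Finset (Fin n)) (α : ℝ) (j : Fin n) : ℝ :=
  if j ∈ K then G.insideInvestment K α j
  else
    G.vb j * (G.xb + ∑ l ∈ K, G.insideInvestment K α l) ^ 2 /
      (∑ l ∈ K, √(G.insideInvestment K α l * G.vb l)) ^ 2

/-- The candidate commitments for the support `K`. -/
def candidates (K : Finset (Fin n)) : Set (Fin n → ℝ) :=
  {x | ∃ α ∈ (G.problem K).solutions, x = G.commitment K α}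

end Game

/-! ### A real random access machine with unit cost -/

/-- Memory: registers for natural numbers, registers for reals, and arrays of reals. -/
structure RamState where
  nat : ℕ → ℕ
  real : ℕ → ℝ
  arr : ℕ → ℕ → ℝ

inductive ArithOp where
  | add
  | sub
  | mul
  | div

noncomputable def ArithOp.eval : ArithOp → ℝ → ℝ → ℝ
  | .add, a, b => a + b
  | .sub, a, b => a - b
  | .mul, a, b => a * b
  | .div, a, b => a / b

/-- Elementary instructions.  The first argument is the destination; all arguments except the
literals `c` are register (or array) numbers, and `i` is a natural number register that holds an
array index. -/
inductive Instr where
  | natConst (d : ℕ) (c : ℕ)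
  | natCopy (d s : ℕ)
  | natSucc (d : ℕ)
  | realConst (d : ℕ) (c : ℤ)
  | arith (d : ℕ) (op : ArithOp) (a b : ℕ)
  | sqrt (d a : ℕ)
  | load (d : ℕ) (array i : ℕ)
  | store (array i : ℕ) (s : ℕ)

/-- The effect of an instruction.  Division by zero and roots of negative numbers give `0`. -/
noncomputable def Instr.apply : Instr → RamState → RamState
  | .natConst d c, s => { s with nat := Function.update s.nat d c }
  | .natCopy d r, s => { s with nat := Function.update s.nat d (s.nat r) }
  | .natSucc d, s => { s with nat := Function.update s.nat d (s.nat d + 1) }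
  | .realConst d c, s => { s with real := Function.update s.real d (c : ℝ) }
  | .arith d op a b, s =>
      { s with real := Function.update s.real d (op.eval (s.real a) (s.real b)) }
  | .sqrt d a, s => { s with real := Function.update s.real d (√(s.real a)) }
  | .load d a i, s => { s with real := Function.update s.real d (s.arr a (s.nat i)) }
  | .store a i r, s =>
      { s with arr := Function.update s.arr a (Function.update (s.arr a) (s.nat i) (s.real r)) }

inductive Test where
  | natLt (i j : ℕ)
  | realLe (a b : ℕ)

def Test.Holds : Test → RamState → Prop
  | .natLt i j, s => s.nat i < s.nat j
  | .realLe a b, s => s.real a ≤ s.real b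

/-- Programs.  A program is a finite object that does not depend on the input. -/
inductive Prog where
  | instr (c : Instr)
  | seq (p q : Prog)
  | ite (t : Test) (p q : Prog)
  | loop (t : Test) (p : Prog)

/-- `Exec p s m s'`: started in state `s`, the program `p` halts in state `s'` after exactly `m`
steps, where each instruction and each evaluation of a test is one step. -/
inductive Exec : Prog → RamState → ℕ → RamState → Prop where
  | instr (c : Instr) (s : RamState) : Exec (.instr c) s 1 (c.apply s)
  | seq {p q : Prog} {s s' s'' : RamState} {m m' : ℕ} :
      Exec p s m s' → Exec q s' m' s'' → Exec (.seq p q) s (m + m') s''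
  | iteTrue {t : Test} {p q : Prog} {s s' : RamState} {m : ℕ} :
      t.Holds s → Exec p s m s' → Exec (.ite t p q) s (m + 1) s'
  | iteFalse {t : Test} {p q : Prog} {s s' : RamState} {m : ℕ} :
      ¬ t.Holds s → Exec q s m s' → Exec (.ite t p q) s (m + 1) s'
  | loopTrue {t : Test} {p : Prog} {s s' s'' : RamState} {m m' : ℕ} :
      t.Holds s → Exec p s m s' → Exec (.loop t p) s' m' s'' →
        Exec (.loop t p) s (m + m' + 1) s''
  | loopFalse {t : Test} {p : Prog} {s : RamState} :
      ¬ t.Holds s → Exec (.loop t p) s 1 s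

/-- The initial memory: the number `n` of battlefields, the number `k` of battlefields in `K`, the
two budgets, a real parameter `α`, and the two arrays of values; everything else is `0`. -/
noncomputable def Game.input {n : ℕ} (G : Game n) (k : ℕ) (α : ℝ) : RamState where
  nat := fun i => if i = 0 then n else if i = 1 then k else 0
  real := fun i => if i = 0 then G.xa else if i = 1 then G.xb else if i = 2 then α else 0
  arr := fun a i =>
    if h : i < n then (if a = 0 then G.va ⟨i, h⟩ else if a = 1 then G.vb ⟨i, h⟩ else 0) else 0

/-- The memory `s` holds the univariate problem `p`: its kind in natural number register `0` and its
coefficients in the first real registers. -/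
def RamState.Encodes (s : RamState) (p : UniProblem) : Prop :=
  s.nat 0 = p.kind.code ∧ ∀ i : Fin p.coeffs.length, s.real i = p.coeffs.get i

/-- The memory `s` holds the vector `x` in array `2`. -/
def RamState.HoldsVector {n : ℕ} (s : RamState) (x : Fin n → ℝ) : Prop :=
  ∀ j : Fin n, s.arr 2 j = x j

/-!
Optimal commitments are found by passing from the investments to the leader's *shares*
`p j = x j / (x j + y j)` of the battlefields, where `y` is the follower's best response to `x`.

By the follower's first-order conditions (`IsBestResponse.exists_multiplier`) there is a
multiplier `L > 0` with `vb j * p j ^ 2 ≤ L * x j` and `vb j * p j * (1 - p j) = L * y j`.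
Summation over `j` eliminates `x` and `y`: the shares lie in the unit cube and in the ball
`(xa + xb) * ∑ vb * p ^ 2 ≤ xa * ∑ vb * p`, an ellipsoid through `0` whose centre is
`c * (1, …, 1)` with `c = xa / (2 * (xa + xb))`.  On the sphere, the commitment is determined by
its shares (`investment`).  The leader's utility is the linear function `∑ va * p`, so by strict
convexity (`OnSphere.dist_le`) the optimal commitment is unique.  Its shares are
`p j = min 1 (c + μ * va j / vb j)` for the `μ > 0` that puts `p` on the sphere
(`isOptimalCommitment_iff`).  The follower invests where `p j < 1`, and hence in an initial
segment of the battlefields.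

The feasible commitments of the leader's problem for `K` correspond in the same way to the
positive points of the sphere with `p j = 1` outside of `K` (`SupportFeasible.exists_share`,
`OnSphere.supportFeasible`); the objective is `∑ va * p` over `K`.  The squared radius of this
section of the sphere is a positive multiple of `B4`.  Hence the problem for `K` has exactly one
solution if `0 ≤ B4`, with `p j = c + μ * va j / vb j` in `K` (`solvesSupport_iff`).  For the
support of the best response to the optimal commitment these are the optimal shares.

The univariate objective is the same linear function, evaluated at a point of the section whose
coordinates in `K` are proportional to `va j / vb j - α` (`onSphere_shareOf`).  It is thus at most
the maximum over the section, with equality only if `c + μ * va j / vb j` is proportional to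
`va j / vb j - α`; for unequal value ratios this means `α = -c / μ` (`solutions_eq`).  For equal
value ratios it is constant, and `uniformBudget` belongs to the optimal shares
(`UniformOn.commitment_eq`).

The two programs are built from compiled arithmetic expressions (`RExpr.compile`), blocks of
assignments (`assign`), and loops over `K` and over its complement.  They are verified with rules
for `Runs`, which bound the time along with the final state.
-/

namespace Game

variable {n : ℕ} (G : Game n)

/-! ### The follower's best response -/

/-- Since `0 / 0 = 0`, the convention for battlefields where nobody invests is built into this form
of the follower's utility. -/
lemma followerUtility_eq {x y : Fin n → ℝ} (hx : ∀ j, 0 ≤ x j) (hy : ∀ j, 0 ≤ y j) :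
    G.followerUtility x y = ∑ j, G.vb j - ∑ j, G.vb j * (x j / (x j + y j)) := by
  rw [followerUtility, ← Finset.sum_sub_distrib]
  refine Finset.sum_congr rfl fun j _ => ?_
  split_ifs with h
  · simp [h.1]
  · have : x j + y j ≠ 0 := fun h0 => h ⟨by linarith [hx j, hy j], by linarith [hx j, hy j]⟩
    field_simp
    ring

variable {G}

/-- The follower does not gain by moving an amount `ε` from battlefield `i` to battlefield `j`. -/
lemma IsBestResponse.transfer {x y : Fin n → ℝ} (hx : ∀ j, 0 ≤ x j) (h : G.IsBestResponse x y)
    {i j : Fin n} (hij : i ≠ j) {ε : ℝ} (hε : 0 ≤ ε) (hεi : ε ≤ y i) :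
    G.vb j * (x j / (x j + y j)) + G.vb i * (x i / (x i + y i)) ≤
      G.vb j * (x j / (x j + (y j + ε))) + G.vb i * (x i / (x i + (y i - ε))) := by
  obtain ⟨⟨hy, hsum⟩, hbest⟩ := h
  set y' : Fin n → ℝ := fun l => if l = i then y i - ε else if l = j then y j + ε else y l with hy'
  have hy'i : y' i = y i - ε := by simp [hy']
  have hy'j : y' j = y j + ε := by simp [hy', hij.symm]
  have hy'l : ∀ l, l ≠ i ∧ l ≠ j → y' l = y l := fun l hl => by simp [hy', hl.1, hl.2]
  have hnonneg : ∀ l, 0 ≤ y' l := by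
    intro l
    by_cases hi : l = i
    · rw [hi, hy'i]; linarith
    by_cases hj : l = j
    · rw [hj, hy'j]; linarith [hy j]
    · rw [hy'l l ⟨hi, hj⟩]; exact hy l
  have hsum' : ∑ l, (y' l - y l) = 0 := by
    rw [Finset.sum_eq_add i j hij (fun l _ hl => by rw [hy'l l hl, sub_self])
      (by simp) (by simp), hy'i, hy'j]
    ring
  have hb := hbest y' ⟨hnonneg, by rw [Finset.sum_sub_distrib] at hsum'; linarith⟩
  rw [followerUtility_eq G hx hnonneg, followerUtility_eq G hx hy] at hb
  have hd : 0 ≤ ∑ l, (G.vb l * (x l / (x l + y' l)) - G.vb l * (x l / (x l + y l))) := by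
    rw [Finset.sum_sub_distrib]; linarith
  rw [Finset.sum_eq_add i j hij (fun l _ hl => by rw [hy'l l hl, sub_self])
      (by simp) (by simp), hy'i, hy'j] at hd
  linarith

/-- The follower only invests where the leader does, and where he invests his marginal utility is
maximal. -/
lemma IsBestResponse.marginal_le {x y : Fin n → ℝ} (hx : ∀ j, 0 ≤ x j)
    (h : G.IsBestResponse x y) {i j : Fin n} (hi : 0 < y i) (hj : 0 < x j) :
    0 < x i ∧
      G.vb j * x j / (x j + y j) ^ 2 ≤ G.vb i * x i / (x i + y i) ^ 2 := by
  have hyj : 0 ≤ y j := h.1.1 j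
  have hvj := G.vb_pos j
  have hvi := G.vb_pos i
  by_cases hij : i = j
  · subst hij
    exact ⟨hj, le_rfl⟩
  have hxi : 0 < x i := by
    by_contra hneg
    have h0 : x i = 0 := le_antisymm (not_lt.1 hneg) (hx i)
    have ht := h.transfer hx hij hi.le le_rfl
    simp only [h0, zero_div, mul_zero, add_zero] at ht
    have : x j / (x j + (y j + y i)) < x j / (x j + y j) :=
      div_lt_div_of_pos_left hj (by linarith) (by linarith)
    linarith [mul_lt_mul_of_pos_left this hvj]
  refine ⟨hxi, ?_⟩
  have key : ∀ ε, 0 < ε → ε ≤ y i →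
      G.vb j * x j / ((x j + y j) * (x j + y j + ε)) ≤
        G.vb i * x i / ((x i + y i) * (x i + y i - ε)) := by
    intro ε h0 h1
    have ht := h.transfer hx hij h0.le h1
    have e1 : G.vb j * (x j / (x j + y j)) - G.vb j * (x j / (x j + (y j + ε))) =
        ε * (G.vb j * x j / ((x j + y j) * (x j + y j + ε))) := by
      have : x j + y j ≠ 0 := by positivity
      have : x j + y j + ε ≠ 0 := by positivity
      have : x j + (y j + ε) ≠ 0 := by positivity
      field_simp
      ring
    have e2 : G.vb i * (x i / (x i + (y i - ε))) - G.vb i * (x i / (x i + y i)) =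
        ε * (G.vb i * x i / ((x i + y i) * (x i + y i - ε))) := by
      have : x i + y i ≠ 0 := by positivity
      have h2 : x i + y i - ε ≠ 0 := by intro h3; linarith
      have : x i + (y i - ε) ≠ 0 := by rwa [← add_sub_assoc]
      field_simp
      ring
    exact le_of_mul_le_mul_left (by linarith) h0
  have l1 : Filter.Tendsto (fun ε : ℝ => G.vb j * x j / ((x j + y j) * (x j + y j + ε)))
      (nhdsWithin 0 (Set.Ioi 0)) (nhds (G.vb j * x j / (x j + y j) ^ 2)) := by
    have : ContinuousAt (fun ε : ℝ => G.vb j * x j / ((x j + y j) * (x j + y j + ε))) 0 := by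
      refine ContinuousAt.div (by fun_prop) (by fun_prop) ?_
      rw [add_zero]
      positivity
    have h2 := this.tendsto
    rw [add_zero, ← sq] at h2
    exact h2.mono_left nhdsWithin_le_nhds
  have l2 : Filter.Tendsto (fun ε : ℝ => G.vb i * x i / ((x i + y i) * (x i + y i - ε)))
      (nhdsWithin 0 (Set.Ioi 0)) (nhds (G.vb i * x i / (x i + y i) ^ 2)) := by
    have : ContinuousAt (fun ε : ℝ => G.vb i * x i / ((x i + y i) * (x i + y i - ε))) 0 := by
      refine ContinuousAt.div (by fun_prop) (by fun_prop) ?_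
      rw [sub_zero]
      positivity
    have h2 := this.tendsto
    rw [sub_zero, ← sq] at h2
    exact h2.mono_left nhdsWithin_le_nhds
  refine le_of_tendsto_of_tendsto l1 l2 ?_
  filter_upwards [Ioc_mem_nhdsGT hi] with ε hε using key ε hε.1 hε.2

/-- The first-order conditions of the follower, in terms of the leader's shares
`x j / (x j + y j)`. -/
lemma IsBestResponse.exists_multiplier {x y : Fin n → ℝ} (hx : IsStrategy G.xa x)
    (h : G.IsBestResponse x y) :
    ∃ L : ℝ, 0 < L ∧ (∀ j, G.vb j * (x j / (x j + y j)) ^ 2 ≤ L * x j) ∧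
      ∀ j, G.vb j * (x j / (x j + y j)) * (1 - x j / (x j + y j)) = L * y j := by
  obtain ⟨i, hi⟩ : ∃ i, 0 < y i := by
    by_contra! hneg
    have := Finset.sum_nonpos (s := Finset.univ) fun i _ => hneg i
    linarith [h.1.2, G.xb_pos]
  obtain ⟨j₀, hj₀⟩ : ∃ j, 0 < x j := by
    by_contra! hneg
    have := Finset.sum_nonpos (s := Finset.univ) fun i _ => hneg i
    linarith [hx.2, G.xa_pos]
  have hxi := (h.marginal_le hx.1 hi hj₀).1
  have hvi := G.vb_pos i
  refine ⟨G.vb i * x i / (x i + y i) ^ 2, by positivity, fun j => ?_, fun j => ?_⟩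
  · rcases (hx.1 j).eq_or_lt with hj | hj
    · simp [← hj]
    have h1 := mul_le_mul_of_nonneg_right (h.marginal_le hx.1 hi hj).2 hj.le
    calc _ = G.vb j * x j / (x j + y j) ^ 2 * x j := by rw [div_pow]; ring
      _ ≤ _ := h1
  · rcases (h.1.1 j).eq_or_lt with hj | hj
    · rcases (hx.1 j).eq_or_lt with hj' | hj'
      · simp [← hj, ← hj']
      · simp [← hj, hj'.ne']
    have hxj := (h.marginal_le hx.1 hj hj₀).1
    rw [le_antisymm (h.marginal_le hx.1 hj hxi).2 (h.marginal_le hx.1 hi hxj).2]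
    have : x j + y j ≠ 0 := by positivity
    field_simp
    ring

/-- Equal marginal utilities on all battlefields suffice for `y` to be the unique best response. -/
lemma bestResponse_of_multiplier {x y : Fin n → ℝ} {L : ℝ} (hx : ∀ j, 0 < x j)
    (hy : IsStrategy G.xb y) (hL : ∀ j, G.vb j * x j / (x j + y j) ^ 2 = L) :
    G.IsBestResponse x y ∧ ∀ y', G.IsBestResponse x y' → y' = y := by
  -- the gap between the utilities of `y` and `y'` is a weighted sum of squares
  have gap : ∀ y', IsStrategy G.xb y' → G.followerUtility x y - G.followerUtility x y' =
      ∑ j, G.vb j * x j * (y' j - y j) ^ 2 / ((x j + y j) ^ 2 * (x j + y' j)) := by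
    intro y' hy'
    have h0 : ∑ j, L * (y' j - y j) = 0 := by
      rw [← Finset.mul_sum, Finset.sum_sub_distrib, hy.2, hy'.2, sub_self, mul_zero]
    rw [followerUtility_eq G (fun j => (hx j).le) hy.1,
      followerUtility_eq G (fun j => (hx j).le) hy'.1,
      sub_sub_sub_cancel_left, ← Finset.sum_sub_distrib, ← add_zero (Finset.sum _ _), ← h0,
      ← Finset.sum_add_distrib]
    refine Finset.sum_congr rfl fun j _ => ?_
    rw [← hL j]
    have h1 : x j + y j ≠ 0 := by linarith [hx j, hy.1 j]
    have h2 : x j + y' j ≠ 0 := by linarith [hx j, hy'.1 j]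
    field_simp
    ring
  have hpos : ∀ y', IsStrategy G.xb y' → ∀ j,
      0 ≤ G.vb j * x j * (y' j - y j) ^ 2 / ((x j + y j) ^ 2 * (x j + y' j)) := by
    intro y' hy' j
    have := G.vb_pos j
    have := hx j
    have := hy.1 j
    have := hy'.1 j
    positivity
  refine ⟨⟨hy, fun y' hy' => ?_⟩, fun y' hy' => funext fun j => ?_⟩
  · have := Finset.sum_nonneg fun j (_ : j ∈ Finset.univ) => hpos y' hy' j
    linarith [gap y' hy']
  · have h0 := gap y' hy'.1
    have h1 := Finset.sum_nonneg fun j (_ : j ∈ Finset.univ) => hpos y' hy'.1 j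
    have h2 := (Finset.sum_eq_zero_iff_of_nonneg fun j (_ : j ∈ Finset.univ) =>
      hpos y' hy'.1 j).1 (by linarith [hy'.2 y hy]) j (Finset.mem_univ j)
    have hv := G.vb_pos j
    have hxj := hx j
    have h3 : 0 < x j + y j := by linarith [hy.1 j]
    have h4 : 0 < x j + y' j := by linarith [hy'.1.1 j]
    rw [div_eq_zero_iff, or_iff_left (by positivity), mul_eq_zero, or_iff_right (by positivity)]
      at h2
    linarith [pow_eq_zero_iff (two_ne_zero) |>.1 h2]

end Game

namespace Game

variable {n : ℕ} (G : Game n)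

/-! ### Winning shares and the sphere -/

/-- The coordinates `p j` of a point of the sphere `(xa + xb) * ∑ vb * p ^ 2 = xa * ∑ vb * p` (an
ellipsoid through `0`, centred at `center`) are the leader's shares of the battlefields when the
follower responds optimally. -/
def OnSphere (p : Fin n → ℝ) : Prop :=
  (G.xa + G.xb) * ∑ j, G.vb j * p j ^ 2 = G.xa * ∑ j, G.vb j * p j

/-- All coordinates of the centre of the sphere are equal to this number. -/
noncomputable def center : ℝ := G.xa / (2 * (G.xa + G.xb))

/-- The follower's squared multiplier that belongs to the shares `p`. -/
noncomputable def multiplier (p : Fin n → ℝ) : ℝ := (∑ j, G.vb j * p j * (1 - p j)) / G.xb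

/-- The leader's commitment that leads to the shares `p`. -/
noncomputable def investment (p : Fin n → ℝ) (j : Fin n) : ℝ :=
  G.vb j * p j ^ 2 / G.multiplier p

/-- The follower's response to `investment p`. -/
noncomputable def response (p : Fin n → ℝ) (j : Fin n) : ℝ :=
  G.vb j * p j * (1 - p j) / G.multiplier p

variable {G}

lemma center_pos : 0 < G.center := by
  have := G.xa_pos
  have := G.xb_pos
  unfold center
  positivity

lemma two_mul_center : 2 * (G.xa + G.xb) * G.center = G.xa := by
  have := G.xa_pos
  have := G.xb_pos
  unfold center
  field_simp

lemma OnSphere.xa_mul_multiplier {p : Fin n → ℝ} (h : G.OnSphere p) :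
    G.multiplier p * G.xa = ∑ j, G.vb j * p j ^ 2 := by
  have hb := G.xb_pos
  have : ∑ j, G.vb j * p j * (1 - p j) = ∑ j, G.vb j * p j - ∑ j, G.vb j * p j ^ 2 := by
    rw [← Finset.sum_sub_distrib]
    exact Finset.sum_congr rfl fun j _ => by ring
  unfold multiplier OnSphere at *
  rw [this]
  field_simp
  linear_combination -h

lemma OnSphere.multiplier_pos [NeZero n] {p : Fin n → ℝ} (h : G.OnSphere p)
    (hp : ∀ j, 0 < p j) : 0 < G.multiplier p := by
  have h1 : 0 < ∑ j, G.vb j * p j ^ 2 :=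
    Finset.sum_pos (fun j _ => mul_pos (G.vb_pos j) (pow_pos (hp j) 2)) ⟨0, Finset.mem_univ _⟩
  rw [← h.xa_mul_multiplier] at h1
  exact pos_of_mul_pos_left h1 G.xa_pos.le

lemma OnSphere.sum_investment [NeZero n] {p : Fin n → ℝ} (h : G.OnSphere p)
    (hp : ∀ j, 0 < p j) : ∑ j, G.investment p j = G.xa := by
  have := h.multiplier_pos hp
  unfold investment
  rw [← Finset.sum_div, ← h.xa_mul_multiplier]
  field_simp

lemma OnSphere.investment_pos [NeZero n] {p : Fin n → ℝ} (h : G.OnSphere p)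
    (hp : ∀ j, 0 < p j) (j : Fin n) : 0 < G.investment p j := by
  have := h.multiplier_pos hp
  have := hp j
  have := G.vb_pos j
  unfold investment
  positivity

/-- A point of the sphere with positive coordinates at most `1` consists of the shares of a
commitment and the best response to it. -/
lemma OnSphere.bestResponse [NeZero n] {p : Fin n → ℝ} (h : G.OnSphere p)
    (hp : ∀ j, 0 < p j) (hp1 : ∀ j, p j ≤ 1) :
    G.IsBestResponse (G.investment p) (G.response p) ∧
      ∀ y, G.IsBestResponse (G.investment p) y → y = G.response p := by
  have hL := h.multiplier_pos hp
  refine bestResponse_of_multiplier (L := G.multiplier p) (h.investment_pos hp)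
    ⟨fun j => ?_, ?_⟩ fun j => ?_
  · have := hp j
    have := G.vb_pos j
    have := sub_nonneg.2 (hp1 j)
    unfold response
    positivity
  · have h1 : ∑ j, G.vb j * p j * (1 - p j) = G.multiplier p * G.xb := by
      have := G.xb_pos
      unfold multiplier
      field_simp
    unfold response
    rw [← Finset.sum_div, h1]
    field_simp
  · have := hp j
    have := G.vb_pos j
    unfold investment response
    have : G.vb j * p j ^ 2 / G.multiplier p + G.vb j * p j * (1 - p j) / G.multiplier p =
      G.vb j * p j / G.multiplier p := by ring
    rw [this]
    field_simp

lemma OnSphere.leaderUtility_investment [NeZero n] {p : Fin n → ℝ} (h : G.OnSphere p)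
    (hp : ∀ j, 0 < p j) :
    G.leaderUtility (G.investment p) (G.response p) = ∑ j, G.va j * p j := by
  have hL := h.multiplier_pos hp
  unfold leaderUtility
  refine Finset.sum_congr rfl fun j _ => ?_
  have := hp j
  have := G.vb_pos j
  unfold investment response
  have : G.vb j * p j ^ 2 / G.multiplier p + G.vb j * p j * (1 - p j) / G.multiplier p =
    G.vb j * p j / G.multiplier p := by ring
  rw [this]
  field_simp

/-- Strict convexity of the ball, quantitatively: if a point `q` of the sphere satisfies the
first-order conditions for maximizing the linear function `∑ va * p`, then any point `p` of the ball
falls behind by at least a multiple of its squared distance to `q`. -/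
lemma OnSphere.dist_le {p q : Fin n → ℝ} {μ : ℝ} (hq : G.OnSphere q)
    (hp : (G.xa + G.xb) * ∑ j, G.vb j * p j ^ 2 ≤ G.xa * ∑ j, G.vb j * p j)
    (hμ : ∀ j, G.vb j * (q j - G.center) * (q j - p j) ≤ μ * G.va j * (q j - p j)) :
    (∑ j, G.vb j * (p j - q j) ^ 2) / 2 ≤ μ * (∑ j, G.va j * q j - ∑ j, G.va j * p j) := by
  have hN : 0 < G.xa + G.xb := add_pos G.xa_pos G.xb_pos
  have h1 : ∑ j, G.vb j * (q j - G.center) * (q j - p j) ≤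
      μ * (∑ j, G.va j * q j - ∑ j, G.va j * p j) := by
    rw [← Finset.sum_sub_distrib, Finset.mul_sum]
    exact Finset.sum_le_sum fun j _ => (hμ j).trans_eq (by ring)
  have h2 : ∑ j, G.vb j * (q j - G.center) * (q j - p j) =
      (∑ j, G.vb j * (p j - q j) ^ 2) / 2 + (∑ j, G.vb j * q j ^ 2 - ∑ j, G.vb j * p j ^ 2) / 2
        - G.center * (∑ j, G.vb j * q j - ∑ j, G.vb j * p j) := by
    rw [← Finset.sum_sub_distrib, ← Finset.sum_sub_distrib, Finset.mul_sum, Finset.sum_div,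
      Finset.sum_div, ← Finset.sum_add_distrib, ← Finset.sum_sub_distrib]
    exact Finset.sum_congr rfl fun j _ => by ring
  have h3 : 0 ≤ (∑ j, G.vb j * q j ^ 2 - ∑ j, G.vb j * p j ^ 2) / 2
        - G.center * (∑ j, G.vb j * q j - ∑ j, G.vb j * p j) := by
    refine nonneg_of_mul_nonneg_right (a := 2 * (G.xa + G.xb)) ?_ (by positivity)
    unfold OnSphere at hq
    have e : 2 * (G.xa + G.xb) * ((∑ j, G.vb j * q j ^ 2 - ∑ j, G.vb j * p j ^ 2) / 2
        - G.center * (∑ j, G.vb j * q j - ∑ j, G.vb j * p j)) =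
        G.xa * ∑ j, G.vb j * p j - (G.xa + G.xb) * ∑ j, G.vb j * p j ^ 2 := by
      linear_combination hq - (∑ j, G.vb j * q j - ∑ j, G.vb j * p j) * two_mul_center (G := G)
    rw [e]
    linarith
  linarith

lemma eq_of_dist_nonpos {p q : Fin n → ℝ} (h : (∑ j, G.vb j * (p j - q j) ^ 2) / 2 ≤ 0) :
    p = q := by
  have h0 : ∀ j ∈ Finset.univ, 0 ≤ G.vb j * (p j - q j) ^ 2 :=
    fun j _ => mul_nonneg (G.vb_pos j).le (sq_nonneg _)
  have h1 := (Finset.sum_eq_zero_iff_of_nonneg h0).1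
    (le_antisymm (by linarith) (Finset.sum_nonneg h0))
  funext j
  have h2 := (mul_eq_zero_iff_left (G.vb_pos j).ne').1 (h1 j (Finset.mem_univ j))
  linarith [pow_eq_zero_iff (two_ne_zero) |>.1 h2]

/-- The shares that result from a commitment and the follower's best response lie in the ball. -/
lemma IsBestResponse.share_mem_ball {x y : Fin n → ℝ} (hx : IsStrategy G.xa x)
    (h : G.IsBestResponse x y) :
    (G.xa + G.xb) * ∑ j, G.vb j * (x j / (x j + y j)) ^ 2 ≤
      G.xa * ∑ j, G.vb j * (x j / (x j + y j)) := by
  obtain ⟨L, hL, h1, h2⟩ := h.exists_multiplier hx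
  have e1 := Finset.sum_le_sum fun j (_ : j ∈ Finset.univ) => h1 j
  have e2 := Finset.sum_congr rfl fun j (_ : j ∈ Finset.univ) => h2 j
  rw [← Finset.mul_sum, hx.2] at e1
  rw [← Finset.mul_sum, h.1.2] at e2
  have e3 : ∑ j, G.vb j * (x j / (x j + y j)) * (1 - x j / (x j + y j)) =
      ∑ j, G.vb j * (x j / (x j + y j)) - ∑ j, G.vb j * (x j / (x j + y j)) ^ 2 := by
    rw [← Finset.sum_sub_distrib]
    exact Finset.sum_congr rfl fun j _ => by ring
  rw [e3] at e2
  nlinarith [mul_le_mul_of_nonneg_left e1 G.xb_pos.le, congrArg (G.xa * ·) e2]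

/-- Shares on the sphere determine the commitment. -/
lemma IsBestResponse.eq_investment {x y : Fin n → ℝ} (hx : IsStrategy G.xa x)
    (h : G.IsBestResponse x y) (hs : G.OnSphere fun j => x j / (x j + y j)) :
    x = G.investment fun j => x j / (x j + y j) := by
  obtain ⟨L, hL, h1, h2⟩ := h.exists_multiplier hx
  have e2 := Finset.sum_congr rfl fun j (_ : j ∈ Finset.univ) => h2 j
  rw [← Finset.mul_sum, h.1.2] at e2
  have hm : G.multiplier (fun j => x j / (x j + y j)) = L := by
    unfold multiplier
    rw [e2, mul_div_assoc, div_self G.xb_pos.ne', mul_one]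
  have e1 : ∑ j, G.vb j * (x j / (x j + y j)) ^ 2 = ∑ j, L * x j := by
    rw [← hs.xa_mul_multiplier, hm, ← Finset.mul_sum, hx.2]
  have e3 := (Finset.sum_eq_sum_iff_of_le fun j _ => h1 j).1 e1
  funext j
  unfold investment
  rw [hm, e3 j (Finset.mem_univ j)]
  field_simp

/-! ### The optimal commitment -/

variable (G) in
/-- The maximizer of the leader's utility over the part of the sphere in the unit cube has this form
for some `μ`. -/
noncomputable def cappedShare (μ : ℝ) (j : Fin n) : ℝ :=
  min 1 (G.center + μ * (G.va j / G.vb j))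

lemma center_lt_one : G.center < 1 := by
  have := G.xa_pos
  have := G.xb_pos
  unfold center
  rw [div_lt_one (by positivity)]
  linarith

lemma cappedShare_pos {μ : ℝ} (hμ : 0 ≤ μ) (j : Fin n) : 0 < G.cappedShare μ j := by
  have := G.va_pos j
  have := G.vb_pos j
  have := center_pos (G := G)
  unfold cappedShare
  exact lt_min one_pos (by positivity)

lemma cappedShare_le_one {μ : ℝ} (j : Fin n) : G.cappedShare μ j ≤ 1 := min_le_left _ _

/-- By the intermediate value theorem: for `μ = 0` the point is the centre of the sphere, and for
large `μ` it is the corner `(1, …, 1)` of the cube, which lies outside. -/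
lemma exists_onSphere_cappedShare [NeZero n] : ∃ μ, 0 < μ ∧ G.OnSphere (G.cappedShare μ) := by
  have ha := G.xa_pos
  have hb := G.xb_pos
  have hV : 0 < ∑ j, G.vb j := Finset.sum_pos (fun j _ => G.vb_pos j) ⟨0, Finset.mem_univ _⟩
  set h : ℝ → ℝ := fun μ => (G.xa + G.xb) * ∑ j, G.vb j * G.cappedShare μ j ^ 2
    - G.xa * ∑ j, G.vb j * G.cappedShare μ j with hh
  have hcont : Continuous h := by
    simp only [hh, cappedShare]
    fun_prop
  have h0 : h 0 < 0 := by
    have : ∀ j, G.cappedShare 0 j = G.center := fun j => by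
      simp [cappedShare, center_lt_one.le]
    simp only [hh, this, ← Finset.sum_mul]
    have h2 := two_mul_center (G := G)
    have h3 := center_pos (G := G)
    have : (G.xa + G.xb) * ((∑ j, G.vb j) * G.center ^ 2) - G.xa * ((∑ j, G.vb j) * G.center) =
        -(G.xa * (∑ j, G.vb j) * G.center / 2) := by
      linear_combination (∑ j, G.vb j) * G.center / 2 * h2
    rw [this]
    have : 0 < G.xa * (∑ j, G.vb j) * G.center / 2 := by positivity
    linarith
  -- from this point on all shares are capped
  set M : ℝ := ∑ j, G.vb j / G.va j with hM
  have hM0 : 0 ≤ M := Finset.sum_nonneg fun j _ => (div_pos (G.vb_pos j) (G.va_pos j)).le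
  have h1 : 0 < h M := by
    have : ∀ j, G.cappedShare M j = 1 := fun j => by
      have h1 : G.vb j / G.va j ≤ M := Finset.single_le_sum
        (f := fun j => G.vb j / G.va j)
        (fun j _ => (div_pos (G.vb_pos j) (G.va_pos j)).le) (Finset.mem_univ j)
      have hva := G.va_pos j
      have hvb := G.vb_pos j
      have h2 := mul_le_mul_of_nonneg_right h1 (div_pos hva hvb).le
      have h3 : G.vb j / G.va j * (G.va j / G.vb j) = 1 := by field_simp
      exact min_eq_left (by linarith [center_pos (G := G)])
    simp only [hh, this, one_pow, mul_one]
    have : 0 < G.xb * ∑ j, G.vb j := by positivity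
    linarith
  obtain ⟨μ, hμ, hμ0⟩ := intermediate_value_Icc hM0 hcont.continuousOn ⟨h0.le, h1.le⟩
  refine ⟨μ, lt_of_le_of_ne hμ.1 ?_, by unfold OnSphere; simp only [hh] at hμ0; linarith⟩
  rintro rfl
  exact h0.ne hμ0

/-- Over the part of the ball with coordinates at most `1`, the leader prefers `cappedShare μ`. -/
lemma OnSphere.cappedShare_dist_le {p : Fin n → ℝ} {μ : ℝ} (hq : G.OnSphere (G.cappedShare μ))
    (hp : (G.xa + G.xb) * ∑ j, G.vb j * p j ^ 2 ≤ G.xa * ∑ j, G.vb j * p j)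
    (hp1 : ∀ j, p j ≤ 1) :
    (∑ j, G.vb j * (p j - G.cappedShare μ j) ^ 2) / 2 ≤
      μ * (∑ j, G.va j * G.cappedShare μ j - ∑ j, G.va j * p j) := by
  refine hq.dist_le hp fun j => ?_
  have hvb := G.vb_pos j
  have e : μ * G.va j = G.vb j * (G.center + μ * (G.va j / G.vb j) - G.center) := by
    field_simp
    ring
  rw [e]
  rcases le_total 1 (G.center + μ * (G.va j / G.vb j)) with h | h
  · have : G.cappedShare μ j = 1 := min_eq_left h
    rw [this]
    gcongr
    exact sub_nonneg.2 (hp1 j)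
  · have : G.cappedShare μ j = G.center + μ * (G.va j / G.vb j) := min_eq_right h
    rw [this]

/-- The optimal commitment is unique. -/
lemma isOptimalCommitment_iff [NeZero n] {μ : ℝ} (hμ : 0 < μ)
    (hq : G.OnSphere (G.cappedShare μ)) (x : Fin n → ℝ) :
    G.IsOptimalCommitment x ↔ x = G.investment (G.cappedShare μ) := by
  have hpos := cappedShare_pos (G := G) hμ.le
  have hbr := hq.bestResponse hpos fun j => cappedShare_le_one j
  have hstrat : IsStrategy G.xa (G.investment (G.cappedShare μ)) :=
    ⟨fun j => (hq.investment_pos hpos j).le, hq.sum_investment hpos⟩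
  have hle : ∀ x y, IsStrategy G.xa x → G.IsBestResponse x y →
      (∑ j, G.vb j * (x j / (x j + y j) - G.cappedShare μ j) ^ 2) / 2 ≤
      μ * (∑ j, G.va j * G.cappedShare μ j - G.leaderUtility x y) := by
    intro x y hx hy
    have hU : G.leaderUtility x y = ∑ j, G.va j * (x j / (x j + y j)) :=
      Finset.sum_congr rfl fun j _ => mul_comm _ _
    rw [hU]
    exact hq.cappedShare_dist_le (hy.share_mem_ball hx) fun j =>
      div_le_one_of_le₀ (by linarith [hy.1.1 j]) (add_nonneg (hx.1 j) (hy.1.1 j))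
  constructor
  · rintro ⟨hx, y, hy, hbest⟩
    have h1 := hbest _ _ hstrat hbr.1
    rw [hq.leaderUtility_investment hpos] at h1
    have h2 := eq_of_dist_nonpos ((hle x y hx hy).trans
      (mul_nonpos_of_nonneg_of_nonpos hμ.le (by linarith)))
    have h3 := hy.eq_investment hx (by rw [h2]; exact hq)
    rwa [h2] at h3
  · rintro rfl
    refine ⟨hstrat, _, hbr.1, fun x y hx hy => ?_⟩
    rw [hq.leaderUtility_investment hpos]
    have h0 : 0 ≤ (∑ j, G.vb j * (x j / (x j + y j) - G.cappedShare μ j) ^ 2) / 2 :=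
      div_nonneg (Finset.sum_nonneg fun j _ => mul_nonneg (G.vb_pos j).le (sq_nonneg _)) two_pos.le
    exact sub_nonneg.1 (nonneg_of_mul_nonneg_right (h0.trans (hle x y hx hy)) hμ)

end Game

namespace Game

variable {n : ℕ} {G : Game n} {K : Finset (Fin n)}

/-! ### The leader's problem for a prescribed support -/

lemma xb_mul_multiplier {p : Fin n → ℝ} (hout : ∀ j, j ∉ K → p j = 1) :
    G.xb * G.multiplier p = ∑ j ∈ K, G.vb j * p j - ∑ j ∈ K, G.vb j * p j ^ 2 := by
  classical
  have hb := G.xb_pos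
  have h2 : ∑ j ∈ Kᶜ, G.vb j * p j * (1 - p j) = 0 := Finset.sum_eq_zero fun j hj => by
    rw [hout j (Finset.mem_compl.1 hj)]
    ring
  unfold multiplier
  rw [mul_div_cancel₀ _ hb.ne', ← Finset.sum_add_sum_compl K, h2, add_zero,
    ← Finset.sum_sub_distrib]
  exact Finset.sum_congr rfl fun j _ => by ring

/-- A feasible commitment for the support `K` comes from a point of the sphere. -/
lemma SupportFeasible.exists_share (hK : K.Nonempty) {x : Fin n → ℝ}
    (h : G.SupportFeasible K x) :
    ∃ p, G.OnSphere p ∧ (∀ j, j ∉ K → p j = 1) ∧ x = G.investment p ∧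
      G.hatU K x = ∑ j ∈ K, G.va j * p j := by
  classical
  obtain ⟨hpos, hsum, hout⟩ := h
  have hb := G.xb_pos
  set S := ∑ l ∈ K, √(x l * G.vb l) with hS
  set X := ∑ l ∈ K, x l with hX
  have hS0 : 0 < S := Finset.sum_pos
    (fun j _ => Real.sqrt_pos.2 (mul_pos (hpos j) (G.vb_pos j))) hK
  have hX0 : 0 < X := Finset.sum_pos (fun j _ => hpos j) hK
  set l := S / (G.xb + X) with hl
  have hl0 : 0 < l := by positivity
  set p : Fin n → ℝ := fun j => if j ∈ K then l * √(x j / G.vb j) else 1 with hp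
  have hsq : ∀ j, G.vb j * p j ^ 2 = l ^ 2 * x j := by
    intro j
    have hv := G.vb_pos j
    have hxj := hpos j
    by_cases hj : j ∈ K
    · simp only [hp, if_pos hj, mul_pow]
      rw [Real.sq_sqrt (by positivity)]
      field_simp
    · simp only [hp, if_neg hj]
      rw [hout j hj, hl]
      field_simp
  have hlin : ∀ j ∈ K, G.vb j * p j = l * √(x j * G.vb j) := by
    intro j hj
    have hv := G.vb_pos j
    have hxj := hpos j
    have : x j * G.vb j = x j / G.vb j * G.vb j ^ 2 := by field_simp
    rw [this, Real.sqrt_mul (by positivity), Real.sqrt_sq hv.le]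
    simp only [hp, if_pos hj]
    ring
  have hout1 : ∀ j, j ∉ K → p j = 1 := fun j hj => if_neg hj
  have s1 : ∑ j, G.vb j * p j ^ 2 = l ^ 2 * G.xa := by
    rw [Finset.sum_congr rfl fun j _ => hsq j, ← Finset.mul_sum, hsum]
  have s2 : ∑ j, G.vb j * p j = l ^ 2 * (G.xa + G.xb) := by
    rw [← Finset.sum_add_sum_compl K, Finset.sum_congr rfl hlin, ← Finset.mul_sum]
    have : ∑ j ∈ Kᶜ, G.vb j * p j = ∑ j ∈ Kᶜ, l ^ 2 * x j := by
      refine Finset.sum_congr rfl fun j hj => ?_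
      rw [← hsq j, hout1 j (Finset.mem_compl.1 hj)]
      ring
    rw [this, ← Finset.mul_sum]
    have e1 : ∑ j ∈ Kᶜ, x j = G.xa - X := by
      rw [← hsum, ← Finset.sum_add_sum_compl K]
      ring
    have e2 : l * S = l ^ 2 * (G.xb + X) := by
      rw [hl]
      field_simp
    rw [e1, e2]
    ring
  have hm : G.multiplier p = l ^ 2 := by
    have : ∑ j, G.vb j * p j * (1 - p j) = ∑ j, G.vb j * p j - ∑ j, G.vb j * p j ^ 2 := by
      rw [← Finset.sum_sub_distrib]
      exact Finset.sum_congr rfl fun j _ => by ring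
    unfold multiplier
    rw [this, s1, s2]
    field_simp
    ring
  refine ⟨p, ?_, hout1, ?_, ?_⟩
  · unfold OnSphere
    rw [s1, s2]
    ring
  · funext j
    unfold investment
    rw [hm, hsq]
    field_simp
  · unfold hatU
    rw [← hS, ← hX, ← hl, Finset.sum_mul]
    refine Finset.sum_congr rfl fun j hj => ?_
    simp only [hp, if_pos hj]
    ring

/-- Conversely, a positive point of the sphere whose coordinates outside of `K` are `1` gives a
feasible commitment for `K`. -/
lemma OnSphere.supportFeasible [NeZero n] {p : Fin n → ℝ} (h : G.OnSphere p)
    (hp : ∀ j, 0 < p j) (hout : ∀ j, j ∉ K → p j = 1) :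
    G.SupportFeasible K (G.investment p) ∧
      G.hatU K (G.investment p) = ∑ j ∈ K, G.va j * p j := by
  classical
  have hb := G.xb_pos
  have hL := h.multiplier_pos hp
  have hr := Real.sqrt_pos.2 hL
  have hrr := Real.mul_self_sqrt hL.le
  set L := G.multiplier p with hLdef
  have e1 : ∀ j, √(G.investment p j * G.vb j) = G.vb j * p j / √L := by
    intro j
    have hv := G.vb_pos j
    have hpj := hp j
    have : G.investment p j * G.vb j = (G.vb j * p j) ^ 2 / L := by
      unfold investment
      rw [← hLdef]
      ring
    rw [this, Real.sqrt_div (by positivity), Real.sqrt_sq (by positivity)]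
  have e2 : ∀ j, √(G.investment p j / G.vb j) = p j / √L := by
    intro j
    have hv := G.vb_pos j
    have hpj := hp j
    have : G.investment p j / G.vb j = p j ^ 2 / L := by
      unfold investment
      rw [← hLdef]
      field_simp
    rw [this, Real.sqrt_div (by positivity), Real.sqrt_sq hpj.le]
  have hxb : G.xb = (∑ j ∈ K, G.vb j * p j - ∑ j ∈ K, G.vb j * p j ^ 2) / L := by
    rw [eq_div_iff hL.ne', hLdef, xb_mul_multiplier hout]
  set T := ∑ j ∈ K, G.vb j * p j with hT
  have hden : G.xb + ∑ j ∈ K, G.investment p j = T / L := by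
    have : ∑ j ∈ K, G.investment p j = (∑ j ∈ K, G.vb j * p j ^ 2) / L := by
      rw [Finset.sum_div]
      rfl
    rw [this, hxb]
    ring
  have hnum : ∑ j ∈ K, √(G.investment p j * G.vb j) = T / √L := by
    rw [Finset.sum_congr rfl fun j _ => e1 j, ← Finset.sum_div]
  have hT0 : 0 < T := by
    have h1 : 0 < G.xb + ∑ j ∈ K, G.investment p j :=
      add_pos_of_pos_of_nonneg hb (Finset.sum_nonneg fun j _ => (h.investment_pos hp j).le)
    rw [hden] at h1
    exact (div_pos_iff_of_pos_right hL).1 h1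
  refine ⟨⟨h.investment_pos hp, h.sum_investment hp, fun j hj => ?_⟩, ?_⟩
  · rw [hden, hnum]
    unfold investment
    rw [← hLdef, hout j hj, div_pow, div_pow, Real.sq_sqrt hL.le]
    field_simp
  · unfold hatU
    rw [hden, hnum, Finset.sum_congr rfl fun j _ => by rw [e2 j], Finset.sum_mul]
    refine Finset.sum_congr rfl fun j _ => ?_
    have : T / √L / (T / L) = √L := by
      rw [div_div_div_cancel_left' _ _ hT0.ne', div_eq_iff hr.ne', hrr]
    rw [this]
    field_simp

open Classical in
variable (G K) in
/-- The maximizer of the leader's utility over the points of the sphere with coordinates `1` outside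
of `K` has this form for some `μ`. -/
noncomputable def supportShare (μ : ℝ) (j : Fin n) : ℝ :=
  if j ∈ K then G.center + μ * (G.va j / G.vb j) else 1

lemma supportShare_of_mem {j : Fin n} (hj : j ∈ K) (μ : ℝ) :
    G.supportShare K μ j = G.center + μ * (G.va j / G.vb j) := if_pos hj

lemma supportShare_of_notMem {j : Fin n} (hj : j ∉ K) (μ : ℝ) :
    G.supportShare K μ j = 1 := if_neg hj

lemma supportShare_pos {μ : ℝ} (hμ : 0 ≤ μ) (j : Fin n) : 0 < G.supportShare K μ j := by
  have := G.va_pos j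
  have := G.vb_pos j
  have := center_pos (G := G)
  unfold supportShare
  split_ifs <;> positivity

lemma sum_vb_affine (s t : ℝ) : ∑ j ∈ K, G.vb j * (s + t * (G.va j / G.vb j)) =
    s * (G.problem K).vbK + t * (G.problem K).vaK := by
  change _ = s * (∑ j ∈ K, G.vb j) + t * ∑ j ∈ K, G.va j
  rw [Finset.mul_sum, Finset.mul_sum, ← Finset.sum_add_distrib]
  refine Finset.sum_congr rfl fun j _ => ?_
  have := G.vb_pos j
  field_simp

lemma sum_va_affine (s t : ℝ) : ∑ j ∈ K, G.va j * (s + t * (G.va j / G.vb j)) =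
    s * (G.problem K).vaK + t * (G.problem K).cK := by
  change _ = s * (∑ j ∈ K, G.va j) + t * ∑ j ∈ K, G.va j ^ 2 / G.vb j
  rw [Finset.mul_sum, Finset.mul_sum, ← Finset.sum_add_distrib]
  refine Finset.sum_congr rfl fun j _ => ?_
  ring

lemma sum_vb_affine_sq (s t : ℝ) : ∑ j ∈ K, G.vb j * (s + t * (G.va j / G.vb j)) ^ 2 =
    s ^ 2 * (G.problem K).vbK + 2 * s * t * (G.problem K).vaK + t ^ 2 * (G.problem K).cK := by
  change _ = s ^ 2 * (∑ j ∈ K, G.vb j) + 2 * s * t * (∑ j ∈ K, G.va j)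
    + t ^ 2 * ∑ j ∈ K, G.va j ^ 2 / G.vb j
  rw [Finset.mul_sum, Finset.mul_sum, Finset.mul_sum, ← Finset.sum_add_distrib,
    ← Finset.sum_add_distrib]
  refine Finset.sum_congr rfl fun j _ => ?_
  have := G.vb_pos j
  field_simp
  ring

lemma sum_vb_supportShare (μ : ℝ) : ∑ j ∈ K, G.vb j * G.supportShare K μ j =
    G.center * (G.problem K).vbK + μ * (G.problem K).vaK := by
  rw [← sum_vb_affine]
  exact Finset.sum_congr rfl fun j hj => by rw [supportShare_of_mem hj]

lemma sum_vb_supportShare_sq (μ : ℝ) : ∑ j ∈ K, G.vb j * G.supportShare K μ j ^ 2 =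
    G.center ^ 2 * (G.problem K).vbK + 2 * G.center * μ * (G.problem K).vaK
      + μ ^ 2 * (G.problem K).cK := by
  rw [← sum_vb_affine_sq]
  exact Finset.sum_congr rfl fun j hj => by rw [supportShare_of_mem hj]

/-- The equation of the sphere for a point whose coordinates outside of `K` are `1`. -/
lemma onSphere_iff {p : Fin n → ℝ} (hout : ∀ j, j ∉ K → p j = 1) :
    G.OnSphere p ↔ (G.xa + G.xb) * ∑ j ∈ K, G.vb j * p j ^ 2 + G.xb * (G.problem K).vbKc =
      G.xa * ∑ j ∈ K, G.vb j * p j := by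
  have e1 : ∑ j, G.vb j * p j ^ 2 = ∑ j ∈ K, G.vb j * p j ^ 2 + (G.problem K).vbKc := by
    rw [← Finset.sum_add_sum_compl K]
    congr 1
    exact Finset.sum_congr rfl fun j hj => by rw [hout j (Finset.mem_compl.1 hj)]; ring
  have e2 : ∑ j, G.vb j * p j = ∑ j ∈ K, G.vb j * p j + (G.problem K).vbKc := by
    rw [← Finset.sum_add_sum_compl K]
    congr 1
    exact Finset.sum_congr rfl fun j hj => by rw [hout j (Finset.mem_compl.1 hj)]; ring
  unfold OnSphere
  rw [e1, e2]
  constructor <;> intro h <;> linear_combination h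

lemma problem_vbK_pos (hK : K.Nonempty) : 0 < (G.problem K).vbK :=
  Finset.sum_pos (fun j _ => G.vb_pos j) hK

lemma problem_vaK_pos (hK : K.Nonempty) : 0 < (G.problem K).vaK :=
  Finset.sum_pos (fun j _ => G.va_pos j) hK

lemma problem_cK_pos (hK : K.Nonempty) : 0 < (G.problem K).cK :=
  Finset.sum_pos (fun j _ => div_pos (pow_pos (G.va_pos j) 2) (G.vb_pos j)) hK

lemma problem_vbKc_nonneg : 0 ≤ (G.problem K).vbKc :=
  Finset.sum_nonneg fun j _ => (G.vb_pos j).le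

lemma problem_B4 : (G.problem K).B4 = G.xa ^ 2 * (G.problem K).vbK ^ 2
    - 4 * G.xb * (G.xa + G.xb) * (G.problem K).vbK * (G.problem K).vbKc := rfl

/-- `B4` is, up to a positive factor, the squared radius of the section of the sphere by `p j = 1`
for all `j ∉ K`. -/
lemma onSphere_supportShare_iff (hK : K.Nonempty) (μ : ℝ) :
    G.OnSphere (G.supportShare K μ) ↔
      (2 * (G.xa + G.xb) * μ) ^ 2 * ((G.problem K).vbK * (G.problem K).cK) = (G.problem K).B4 := by
  have hc := two_mul_center (G := G)
  have hN : G.xa + G.xb ≠ 0 := (add_pos G.xa_pos G.xb_pos).ne'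
  have hV := (problem_vbK_pos (G := G) hK).ne'
  rw [onSphere_iff fun j hj => supportShare_of_notMem hj μ,
    sum_vb_supportShare, sum_vb_supportShare_sq, problem_B4]
  set V := (G.problem K).vbK
  set W := (G.problem K).vaK
  set v := (G.problem K).vbKc
  set C := (G.problem K).cK
  rw [← sub_eq_zero, ← sub_eq_zero (a := _ * (V * C)),
    ← mul_eq_zero_iff_left (a := 4 * (G.xa + G.xb) * V)
      (by simpa using And.intro hN hV)]
  have e : (G.xa + G.xb) * (G.center ^ 2 * V + 2 * G.center * μ * W + μ ^ 2 * C) + G.xb * v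
      - G.xa * (G.center * V + μ * W) = (G.xa + G.xb) * μ ^ 2 * C + G.xb * v
        - (G.xa + G.xb) * G.center ^ 2 * V := by
    linear_combination (G.center * V + μ * W) * hc
  rw [e]
  have e2 : 4 * (G.xa + G.xb) * V * ((G.xa + G.xb) * μ ^ 2 * C + G.xb * v
        - (G.xa + G.xb) * G.center ^ 2 * V) = (2 * (G.xa + G.xb) * μ) ^ 2 * (V * C) -
      (G.xa ^ 2 * V ^ 2 - 4 * G.xb * (G.xa + G.xb) * V * v) := by
    linear_combination -(V ^ 2) * (2 * (G.xa + G.xb) * G.center + G.xa) * hc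
  rw [e2]

variable (G K) in
/-- The value of `μ` for which `supportShare K μ` lies on the sphere. -/
noncomputable def slope : ℝ :=
  √((G.problem K).B4 / ((G.problem K).vbK * (G.problem K).cK)) / (2 * (G.xa + G.xb))

lemma slope_nonneg : 0 ≤ G.slope K :=
  div_nonneg (Real.sqrt_nonneg _) (mul_nonneg two_pos.le (add_pos G.xa_pos G.xb_pos).le)

lemma slope_pos (hK : K.Nonempty) (hB : 0 < (G.problem K).B4) : 0 < G.slope K :=
  div_pos (Real.sqrt_pos.2 (div_pos hB (mul_pos (problem_vbK_pos hK) (problem_cK_pos hK))))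
    (mul_pos two_pos (add_pos G.xa_pos G.xb_pos))

/-- With `B4 = 0` this is the only point of the sphere with coordinates `1` outside of `K`. -/
lemma onSphere_supportShare_slope (hK : K.Nonempty) (hB : 0 ≤ (G.problem K).B4) :
    G.OnSphere (G.supportShare K (G.slope K)) := by
  rw [onSphere_supportShare_iff hK]
  have hN := add_pos G.xa_pos G.xb_pos
  have hVC := mul_pos (problem_vbK_pos (G := G) hK) (problem_cK_pos (G := G) hK)
  unfold slope
  rw [mul_div_cancel₀ _ (by positivity), Real.sq_sqrt (by positivity),
    div_mul_cancel₀ _ hVC.ne']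

lemma OnSphere.slope_eq (hK : K.Nonempty) {μ : ℝ} (hμ : 0 < μ)
    (h : G.OnSphere (G.supportShare K μ)) : 0 < (G.problem K).B4 ∧ G.slope K = μ := by
  have hN := add_pos G.xa_pos G.xb_pos
  have hVC := mul_pos (problem_vbK_pos (G := G) hK) (problem_cK_pos (G := G) hK)
  rw [onSphere_supportShare_iff hK] at h
  refine ⟨by rw [← h]; positivity, ?_⟩
  unfold slope
  rw [← h, mul_div_cancel_right₀ _ hVC.ne', Real.sqrt_sq (by positivity)]
  field_simp

/-- Among the points of the sphere with coordinates `1` outside of `K`, the leader prefers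
`supportShare K μ`. -/
lemma OnSphere.sum_le_supportShare {μ : ℝ} (hμ : 0 ≤ μ) (hq : G.OnSphere (G.supportShare K μ))
    {p : Fin n → ℝ} (hp : G.OnSphere p) (hout : ∀ j, j ∉ K → p j = 1) :
    ∑ j ∈ K, G.va j * p j ≤ ∑ j ∈ K, G.va j * G.supportShare K μ j ∧
      (∑ j ∈ K, G.va j * G.supportShare K μ j ≤ ∑ j ∈ K, G.va j * p j →
        p = G.supportShare K μ) := by
  have hd := hq.dist_le (p := p) (μ := μ) hp.le fun j => by
    by_cases hj : j ∈ K
    · have := G.vb_pos j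
      refine le_of_eq ?_
      rw [supportShare_of_mem hj]
      field_simp
      ring
    · rw [supportShare_of_notMem hj, hout j hj, sub_self, mul_zero, mul_zero]
  have e : ∑ j, G.va j * G.supportShare K μ j - ∑ j, G.va j * p j =
      ∑ j ∈ K, G.va j * G.supportShare K μ j - ∑ j ∈ K, G.va j * p j := by
    rw [← Finset.sum_add_sum_compl K, ← Finset.sum_add_sum_compl K (fun j => G.va j * p j)]
    have : ∑ j ∈ Kᶜ, G.va j * p j = ∑ j ∈ Kᶜ, G.va j * G.supportShare K μ j :=
      Finset.sum_congr rfl fun j hj => by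
        rw [supportShare_of_notMem (Finset.mem_compl.1 hj), hout j (Finset.mem_compl.1 hj)]
    rw [this]
    ring
  rw [e] at hd
  have hback : ∑ j ∈ K, G.va j * G.supportShare K μ j ≤ ∑ j ∈ K, G.va j * p j →
      p = G.supportShare K μ := fun h =>
    eq_of_dist_nonpos (hd.trans (mul_nonpos_of_nonneg_of_nonpos hμ (by linarith)))
  refine ⟨?_, hback⟩
  by_contra! hlt
  exact hlt.ne' (by rw [hback hlt.le])

/-- The leader's problem for `K` has exactly one solution. -/
lemma solvesSupport_iff [NeZero n] (hK : K.Nonempty) (hB : 0 ≤ (G.problem K).B4)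
    (x : Fin n → ℝ) :
    G.SolvesSupport K x ↔ x = G.investment (G.supportShare K (G.slope K)) := by
  have hq := onSphere_supportShare_slope hK hB
  have hf := hq.supportFeasible (supportShare_pos slope_nonneg)
    (fun j hj => supportShare_of_notMem hj _)
  constructor
  · rintro ⟨hx, hbest⟩
    obtain ⟨p, hp, hout, rfl, hU⟩ := hx.exists_share hK
    have h1 := hbest _ hf.1
    rw [hf.2, hU] at h1
    rw [(hq.sum_le_supportShare slope_nonneg hp hout).2 h1]
  · rintro rfl
    refine ⟨hf.1, fun x' hx' => ?_⟩
    obtain ⟨p, hp, hout, rfl, hU⟩ := hx'.exists_share hK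
    rw [hf.2, hU]
    exact (hq.sum_le_supportShare slope_nonneg hp hout).1

/-! ### The univariate problem -/

lemma problem_phi1 (α : ℝ) : (G.problem K).phi1 α =
    G.xa * ((G.problem K).vaK - (G.problem K).vbK * α) ^ 2
      - 2 * G.xb * (G.problem K).vbKc * (G.problem K).A1 α := by
  simp only [UniProblem.phi1, UniProblem.A1, problem]
  ring

lemma problem_phi2 (α : ℝ) : (G.problem K).phi2 α =
    G.xa ^ 2 * ((G.problem K).vaK - (G.problem K).vbK * α) ^ 2
      - 4 * G.xb * (G.xa + G.xb) * (G.problem K).vbKc * (G.problem K).A1 α := by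
  simp only [UniProblem.phi2, UniProblem.A1, problem]
  ring

lemma problem_A1 (α : ℝ) :
    (G.problem K).A1 α = ∑ j ∈ K, G.vb j * (G.va j / G.vb j - α) ^ 2 := by
  have e : ∀ j, G.va j / G.vb j - α = -α + 1 * (G.va j / G.vb j) := fun j => by ring
  simp only [e]
  rw [sum_vb_affine_sq, UniProblem.A1]
  ring

lemma problem_A1_nonneg (α : ℝ) : 0 ≤ (G.problem K).A1 α := by
  rw [problem_A1]
  exact Finset.sum_nonneg fun j _ => mul_nonneg (G.vb_pos j).le (sq_nonneg _)

lemma problem_A1_pos (hK : ¬ G.UniformOn K) (α : ℝ) : 0 < (G.problem K).A1 α := by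
  refine lt_of_le_of_ne (problem_A1_nonneg α) fun h0 => hK ?_
  rw [problem_A1, eq_comm, Finset.sum_eq_zero_iff_of_nonneg
    fun j _ => mul_nonneg (G.vb_pos j).le (sq_nonneg _)] at h0
  have : ∀ j ∈ K, G.va j / G.vb j = α := fun j hj => by
    have h1 := (mul_eq_zero_iff_left (G.vb_pos j).ne').1 (h0 j hj)
    linarith [pow_eq_zero_iff (two_ne_zero) |>.1 h1]
  intro j hj h hh
  rw [this j hj, this h hh]

/-- The three kinds of feasible problems. -/
lemma kind_cases (h : (G.problem K).kind ≠ .infeasible) :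
    (G.UniformOn K ∧ 0 ≤ (G.problem K).B4 ∧ (G.problem K).kind = .uniform) ∨
    (¬ G.UniformOn K ∧ 0 < (G.problem K).B4 ∧ K = Finset.univ ∧ (G.problem K).kind = .full) ∨
    (¬ G.UniformOn K ∧ 0 < (G.problem K).B4 ∧ K ≠ Finset.univ ∧
      (G.problem K).kind = .proper) := by
  have hk : (G.problem K).kind = G.problemKind K (G.problem K).B4 := rfl
  rw [hk] at h ⊢
  unfold problemKind at *
  split_ifs at * <;> simp_all

lemma B4_nonneg_of_kind (h : (G.problem K).kind ≠ .infeasible) : 0 ≤ (G.problem K).B4 := by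
  rcases kind_cases h with h | h | h
  exacts [h.2.1, h.2.1.le, h.2.1.le]

lemma kind_ne_infeasible (h : 0 < (G.problem K).B4) : (G.problem K).kind ≠ .infeasible := by
  have hk : (G.problem K).kind = G.problemKind K (G.problem K).B4 := rfl
  rw [hk]
  unfold problemKind
  split_ifs <;> first | (exfalso; linarith) | simp

lemma mem_domain_iff (h : (G.problem K).kind ≠ .infeasible) {α : ℝ} :
    α ∈ (G.problem K).domain ↔ 0 ≤ (G.problem K).phi2 α := and_iff_right h

lemma UniformOn.exists_ratio (hK : K.Nonempty) (h : G.UniformOn K) :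
    ∃ r, 0 < r ∧ (∀ j ∈ K, G.va j = r * G.vb j) ∧ (G.problem K).vaK = r * (G.problem K).vbK ∧
      (G.problem K).cK = r ^ 2 * (G.problem K).vbK := by
  obtain ⟨i, hi⟩ := hK
  have hva : ∀ j ∈ K, G.va j = G.va i / G.vb i * G.vb j := fun j hj => by
    rw [← h j hj i hi, div_mul_cancel₀ _ (G.vb_pos j).ne']
  refine ⟨_, div_pos (G.va_pos i) (G.vb_pos i), hva, ?_, ?_⟩
  · change ∑ j ∈ K, G.va j = _ * ∑ j ∈ K, G.vb j
    rw [Finset.mul_sum, Finset.sum_congr rfl hva]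
  · change ∑ j ∈ K, G.va j ^ 2 / G.vb j = _ * ∑ j ∈ K, G.vb j
    rw [Finset.mul_sum]
    refine Finset.sum_congr rfl fun j hj => ?_
    have := G.vb_pos j
    rw [hva j hj]
    field_simp

lemma UniformOn.phi2_nonneg (hK : K.Nonempty) (h : G.UniformOn K) (hB : 0 ≤ (G.problem K).B4)
    (α : ℝ) : 0 ≤ (G.problem K).phi2 α := by
  obtain ⟨r, -, -, h1, h2⟩ := h.exists_ratio hK
  have : (G.problem K).phi2 α = (G.problem K).B4 * (r - α) ^ 2 := by
    rw [problem_phi2, UniProblem.A1, h1, h2, problem_B4]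
    ring
  rw [this]
  positivity

/-- The domain consists of two closed rays. -/
lemma lo_le_hi_and_domain_eq (hK : K.Nonempty) (h : (G.problem K).kind ≠ .infeasible) :
    (G.problem K).lo ≤ (G.problem K).hi ∧
      (G.problem K).domain = Set.Iic (G.problem K).lo ∪ Set.Ici (G.problem K).hi := by
  set A := (G.problem K).B4 with hA
  set B := (G.problem K).B5 with hB
  set C := (G.problem K).B6 with hC
  have hlo : (G.problem K).lo = (-B - √(B ^ 2 - 4 * A * C)) / (2 * A) := rfl
  have hhi : (G.problem K).hi = (-B + √(B ^ 2 - 4 * A * C)) / (2 * A) := rfl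
  have hphi : ∀ α, (G.problem K).phi2 α = A * α ^ 2 + B * α + C := fun α => rfl
  rcases (B4_nonneg_of_kind h).eq_or_lt with h0 | hpos
  · -- here `lo = hi = 0`, as divisions by zero, and the domain is the whole line
    have hu : G.UniformOn K := by
      rcases kind_cases h with h | h | h
      exacts [h.1, absurd h0 h.2.1.ne, absurd h0 h.2.1.ne]
    rw [← hA] at h0
    rw [hlo, hhi, ← h0]
    simp only [mul_zero, div_zero]
    refine ⟨le_rfl, ?_⟩
    rw [Set.Iic_union_Ici]
    refine Set.eq_univ_of_forall fun α => (mem_domain_iff h).2 (hu.phi2_nonneg hK ?_ α)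
    exact B4_nonneg_of_kind h
  · rw [← hA] at hpos
    have hD : 0 ≤ B ^ 2 - 4 * A * C := by
      -- the discriminant is nonnegative because `phi2` is nonpositive at this point
      set α₀ := (G.problem K).vaK / (G.problem K).vbK with hα₀
      have h1 : (G.problem K).phi2 α₀ ≤ 0 := by
        rw [problem_phi2, hα₀, mul_div_cancel₀ _ (problem_vbK_pos hK).ne', sub_self]
        have := G.xa_pos
        have := G.xb_pos
        have := problem_vbKc_nonneg (G := G) (K := K)
        have := problem_A1_nonneg (G := G) (K := K) α₀
        have : 0 ≤ 4 * G.xb * (G.xa + G.xb) * (G.problem K).vbKc * (G.problem K).A1 α₀ := by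
          positivity
        linarith
      rw [hphi] at h1
      nlinarith [sq_nonneg (2 * A * α₀ + B), mul_nonneg hpos.le (neg_nonneg.2 h1)]
    have hs := Real.sqrt_nonneg (B ^ 2 - 4 * A * C)
    have hss := Real.mul_self_sqrt hD
    set s := √(B ^ 2 - 4 * A * C) with hsdef
    refine ⟨?_, ?_⟩
    · rw [hlo, hhi]
      gcongr
      linarith
    · ext α
      rw [mem_domain_iff h, hphi, Set.mem_union, Set.mem_Iic, Set.mem_Ici, hlo, hhi,
        le_div_iff₀ (by positivity), div_le_iff₀ (by positivity)]
      have e : 4 * A * (A * α ^ 2 + B * α + C) =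
          (α * (2 * A) - (-B - s)) * (α * (2 * A) - (-B + s)) := by
        linear_combination hss
      have hA4 : 0 < 4 * A := by positivity
      rw [← mul_nonneg_iff_of_pos_left hA4, e, mul_nonneg_iff]
      constructor
      · rintro (⟨_, h2⟩ | ⟨h1, _⟩)
        · exact Or.inr (by linarith)
        · exact Or.inl (by linarith)
      · rintro (h1 | h1)
        · exact Or.inr ⟨by linarith, by linarith⟩
        · exact Or.inl ⟨by linarith, by linarith⟩

/-- The commitment is determined by the investments inside of `K`. -/
lemma commitment_eq_investment [NeZero n] {p : Fin n → ℝ} (hs : G.OnSphere p)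
    (hp : ∀ j, 0 < p j) (hout : ∀ j, j ∉ K → p j = 1) {α : ℝ}
    (h : ∀ j ∈ K, G.insideInvestment K α j = G.investment p j) :
    G.commitment K α = G.investment p := by
  funext j
  unfold commitment
  split_ifs with hj
  · exact h j hj
  · rw [((hs.supportFeasible hp hout).1).2.2 j hj,
      Finset.sum_congr (f := G.insideInvestment K α) rfl h,
      Finset.sum_congr (s₂ := K) (f := fun l => √(G.insideInvestment K α l * G.vb l))
        (g := fun l => √(G.investment p l * G.vb l)) rfl
        fun l hl => by rw [h l hl]]

/-! ### Equal value ratios -/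

/-- For equal value ratios the optimal shares inside of `K` are all equal to some `P`, and the
leader's total investment `X` in `K` satisfies `P = X / (xb + X)`. -/
lemma UniformOn.commitment_eq [NeZero n] (hK : K.Nonempty) (h : G.UniformOn K)
    (hB : 0 ≤ (G.problem K).B4) (hk : (G.problem K).kind = .uniform) (α : ℝ) :
    G.commitment K α = G.investment (G.supportShare K (G.slope K)) ∧
      (G.problem K).objective α = ∑ j ∈ K, G.va j * G.supportShare K (G.slope K) j := by
  obtain ⟨r, hr, hva, h1, h2⟩ := h.exists_ratio hK
  have ha := G.xa_pos
  have hb := G.xb_pos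
  have hc := center_pos (G := G)
  have hV := problem_vbK_pos (G := G) hK
  have hv := problem_vbKc_nonneg (G := G) (K := K)
  have hq := onSphere_supportShare_slope hK hB
  have hqpos := supportShare_pos (G := G) (K := K) (slope_nonneg (G := G) (K := K))
  have hL := hq.multiplier_pos hqpos
  have hLb := xb_mul_multiplier (G := G) (p := G.supportShare K (G.slope K)) (K := K)
    fun j hj => supportShare_of_notMem hj (G.slope K)
  rw [sum_vb_supportShare, sum_vb_supportShare_sq, h1, h2] at hLb
  -- all shares inside of `K` are equal to `P`
  set P := G.center + G.slope K * r with hP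
  have hP0 : 0 < P := by
    have := slope_nonneg (G := G) (K := K)
    positivity
  have hqK : ∀ j ∈ K, G.supportShare K (G.slope K) j = P := fun j hj => by
    rw [supportShare_of_mem hj, hva j hj, mul_div_cancel_right₀ _ (G.vb_pos j).ne']
  set X := (G.problem K).uniformBudget with hX
  have hXP : X = P * (G.xb + X) := by
    have hX' : X = (G.xa * (G.problem K).vbK - 2 * G.xb * (G.problem K).vbKc +
        √(G.problem K).B4) / (2 * ((G.problem K).vbKc + (G.problem K).vbK)) := by
      rw [problem_B4, hX]
      unfold UniProblem.uniformBudget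
      congr 3
      change G.xa ^ 2 * _ - 4 * G.xa * G.xb * _ * _ - 4 * G.xb ^ 2 * _ * _ = _
      ring
    have hP' : P = (G.xa * (G.problem K).vbK + √(G.problem K).B4) /
        (2 * (G.xa + G.xb) * (G.problem K).vbK) := by
      rw [hP, slope, h2, center]
      have : (G.problem K).B4 / ((G.problem K).vbK * (r ^ 2 * (G.problem K).vbK)) =
          (G.problem K).B4 / (r * (G.problem K).vbK) ^ 2 := by ring
      rw [this, Real.sqrt_div hB, Real.sqrt_sq (by positivity)]
      field_simp
    have hss := Real.mul_self_sqrt hB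
    set s := √(G.problem K).B4 with hs
    rw [problem_B4] at hss
    rw [hX', hP']
    field_simp
    linear_combination -hss
  have hL' : G.xb * G.multiplier (G.supportShare K (G.slope K)) =
      (G.problem K).vbK * P * (1 - P) := by
    rw [hLb, hP]
    ring
  have hXP' : X * (1 - P) = P * G.xb := by linear_combination hXP
  have hP1 : 0 < 1 - P := by
    have : 0 < (G.problem K).vbK * P * (1 - P) := by rw [← hL']; positivity
    exact (mul_pos_iff_of_pos_left (by positivity)).1 this
  have hX0 : 0 < X := by
    have : 0 < X * (1 - P) := by rw [hXP']; positivity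
    exact (mul_pos_iff_of_pos_right hP1).1 this
  refine ⟨commitment_eq_investment hq hqpos (fun j hj => supportShare_of_notMem hj _)
    fun j hj => ?_, ?_⟩
  · unfold insideInvestment investment
    simp only [hk]
    rw [← hX, h1, hqK j hj, hva j hj]
    have e : G.multiplier (G.supportShare K (G.slope K)) =
        (G.problem K).vbK * P * (1 - P) / G.xb := by
      rw [← hL']
      field_simp
    rw [e]
    have : 1 - P ≠ 0 := hP1.ne'
    field_simp
    linear_combination G.vb j * hXP'
  · unfold UniProblem.objective
    simp only [hk]
    rw [← hX, Finset.sum_congr rfl fun j hj => by rw [hqK j hj], ← Finset.sum_mul]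
    change (G.problem K).vaK * X / (G.xb + X) = (G.problem K).vaK * P
    rw [div_eq_iff (by positivity)]
    linear_combination (G.problem K).vaK * hXP

/-! ### Unequal value ratios -/

lemma objective_of_ne_uniform {p : UniProblem} (h : p.kind ≠ .uniform) (α : ℝ) :
    p.objective α =
      (p.cK - α * p.vaK) * (p.vaK - α * p.vbK) / (p.yHat α * p.xb + p.A1 α) := by
  unfold UniProblem.objective
  split
  · contradiction
  · rfl

/-- `yHat` is positive and solves the quadratic equation that expresses the budget constraint. -/
lemma yHat_spec (hK : ¬ G.UniformOn K) (hk : (G.problem K).kind ≠ .infeasible) {α : ℝ}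
    (hα : 0 ≤ (G.problem K).phi2 α) :
    0 < (G.problem K).yHat α ∧
      G.xa * ((G.problem K).vaK - (G.problem K).vbK * α) ^ 2 * (G.problem K).yHat α =
        (G.problem K).A1 α * ((G.problem K).vaK - (G.problem K).vbK * α) ^ 2 +
          (G.problem K).vbKc * (G.xb * (G.problem K).yHat α + (G.problem K).A1 α) ^ 2 := by
  have ha := G.xa_pos
  have hb := G.xb_pos
  have hA := problem_A1_pos hK α
  rcases kind_cases hk with h | ⟨-, -, rfl, h⟩ | ⟨-, -, hKu, h⟩
  · exact absurd h.1 hK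
  · have hy : (G.problem Finset.univ).yHat α = (G.problem Finset.univ).A1 α / G.xa := by
      unfold UniProblem.yHat
      simp only [h]
      rfl
    have hv : (G.problem Finset.univ).vbKc = 0 := by
      change ∑ j ∈ (Finset.univ)ᶜ, G.vb j = 0
      simp
    rw [hy, hv]
    refine ⟨by positivity, ?_⟩
    field_simp
    ring
  · have hv : 0 < (G.problem K).vbKc := Finset.sum_pos (fun j _ => G.vb_pos j)
      (Finset.nonempty_iff_ne_empty.2 (by simpa using hKu))
    have hy : (G.problem K).yHat α = ((G.problem K).phi1 α
        - ((G.problem K).vaK - (G.problem K).vbK * α) * √((G.problem K).phi2 α)) /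
          (2 * G.xb ^ 2 * (G.problem K).vbKc) := by
      unfold UniProblem.yHat
      simp only [h]
      rfl
    have h1 := problem_phi1 (G := G) (K := K) α
    have h2 := problem_phi2 (G := G) (K := K) α
    have hss := Real.mul_self_sqrt hα
    set s := √((G.problem K).phi2 α)
    set T := (G.problem K).vaK - (G.problem K).vbK * α
    set v := (G.problem K).vbKc
    set A := (G.problem K).A1 α
    set f1 := (G.problem K).phi1 α
    set f2 := (G.problem K).phi2 α
    have hdisc : f1 ^ 2 - (T * s) ^ 2 = 4 * G.xb ^ 2 * v * (v * A ^ 2 + A * T ^ 2) := by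
      have : (T * s) ^ 2 = T ^ 2 * f2 := by rw [← hss]; ring
      rw [this, h1, h2]
      ring
    have hf1 : 0 < f1 := by
      have e : G.xa * f1 = f2 + (2 * G.xa + 4 * G.xb) * G.xb * v * A := by
        rw [h1, h2]
        ring
      have : 0 < (2 * G.xa + 4 * G.xb) * G.xb * v * A := by positivity
      exact (mul_pos_iff_of_pos_left ha).1 (by linarith)
    have hlt : T * s < f1 := by
      have : 0 < 4 * G.xb ^ 2 * v * (v * A ^ 2 + A * T ^ 2) := by positivity
      exact lt_of_pow_lt_pow_left₀ 2 hf1.le (by linarith)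
    set Y := (G.problem K).yHat α
    have hY : 2 * G.xb ^ 2 * v * Y = f1 - T * s := by
      rw [hy]
      field_simp
    refine ⟨by rw [hy]; exact div_pos (by linarith) (by positivity), ?_⟩
    have hne : 4 * G.xb ^ 2 * v ≠ 0 := by positivity
    refine mul_left_cancel₀ hne ?_
    rw [h1] at hY hdisc
    linear_combination -(2 * G.xb ^ 2 * v * Y - (G.xa * T ^ 2 - 2 * G.xb * v * A) + T * s
      - 2 * T * s) * hY + hdisc

open Classical in
variable (G K) in
/-- The shares that belong to the parameter `α`.  They may be negative or exceed `1`. -/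
noncomputable def shareOf (α : ℝ) (j : Fin n) : ℝ :=
  if j ∈ K then ((G.problem K).vaK - (G.problem K).vbK * α) /
    ((G.problem K).yHat α * G.xb + (G.problem K).A1 α) * (G.va j / G.vb j - α)
  else 1

lemma shareOf_of_notMem {j : Fin n} (hj : j ∉ K) (α : ℝ) : G.shareOf K α j = 1 := if_neg hj

lemma shareOf_of_mem {j : Fin n} (hj : j ∈ K) (α : ℝ) :
    G.shareOf K α j = ((G.problem K).vaK - (G.problem K).vbK * α) /
    ((G.problem K).yHat α * G.xb + (G.problem K).A1 α) * (G.va j / G.vb j - α) := if_pos hj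

/-- The objective function is the leader's utility at a point of the sphere. -/
lemma onSphere_shareOf (hK : ¬ G.UniformOn K) (hk : (G.problem K).kind ≠ .infeasible) {α : ℝ}
    (hα : 0 ≤ (G.problem K).phi2 α) :
    G.OnSphere (G.shareOf K α) ∧
      (G.problem K).objective α = ∑ j ∈ K, G.va j * G.shareOf K α j := by
  have hb := G.xb_pos
  obtain ⟨hY, hq⟩ := yHat_spec hK hk hα
  have hA := problem_A1_pos hK α
  have hku : (G.problem K).kind ≠ .uniform := by
    rcases kind_cases hk with h | h | h
    · exact absurd h.1 hK
    · simp [h.2.2.2]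
    · simp [h.2.2.2]
  have hD : 0 < (G.problem K).yHat α * G.xb + (G.problem K).A1 α := by positivity
  rw [onSphere_iff fun j hj => shareOf_of_notMem hj α, objective_of_ne_uniform hku]
  have hs : ∀ j ∈ K, G.shareOf K α j =
      -(α * (((G.problem K).vaK - (G.problem K).vbK * α) /
        ((G.problem K).yHat α * G.xb + (G.problem K).A1 α))) +
      ((G.problem K).vaK - (G.problem K).vbK * α) /
        ((G.problem K).yHat α * G.xb + (G.problem K).A1 α) * (G.va j / G.vb j) := by
    intro j hj
    rw [shareOf_of_mem hj]
    ring
  rw [Finset.sum_congr rfl fun j hj => by rw [hs j hj],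
    Finset.sum_congr (f := fun j => G.vb j * G.shareOf K α j) rfl fun j hj => by rw [hs j hj],
    Finset.sum_congr (f := fun j => G.va j * G.shareOf K α j) rfl fun j hj => by rw [hs j hj],
    sum_vb_affine, sum_va_affine, sum_vb_affine_sq]
  change _ ∧ _ / ((G.problem K).yHat α * G.xb + _) = _
  set Y := (G.problem K).yHat α
  have hAdef : (G.problem K).A1 α = (G.problem K).cK - 2 * α * (G.problem K).vaK
    + α ^ 2 * (G.problem K).vbK := rfl
  set A := (G.problem K).A1 α
  set W := (G.problem K).vaK
  set V := (G.problem K).vbK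
  have hC : (G.problem K).cK = A + 2 * α * W - α ^ 2 * V := by rw [hAdef]; ring
  rw [hC]
  clear_value A
  constructor
  · field_simp
    linear_combination -G.xb * hq
  · field_simp
    ring

variable (G K) in
/-- The maximizer of the objective function for unequal value ratios. -/
noncomputable def bestParam : ℝ := -(G.center / G.slope K)

/-- At `bestParam`, the quantity `yHat` is the root of the quadratic equation that belongs to the
multiplier of the optimal shares. -/
lemma yHat_bestParam [NeZero n] (hKn : K.Nonempty) (hK : ¬ G.UniformOn K)
    (hk : (G.problem K).kind ≠ .infeasible) (hB : 0 < (G.problem K).B4) :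
    0 ≤ (G.problem K).phi2 (G.bestParam K) ∧
      G.slope K ^ 2 * (G.problem K).yHat (G.bestParam K) =
        G.multiplier (G.supportShare K (G.slope K)) := by
  have ha := G.xa_pos
  have hb := G.xb_pos
  have hμ := slope_pos hKn hB
  have hq := onSphere_supportShare_slope hKn hB.le
  have hqout : ∀ j, j ∉ K → G.supportShare K (G.slope K) j = 1 :=
    fun j hj => supportShare_of_notMem hj _
  have hL := xb_mul_multiplier (G := G) hqout
  have hs := (onSphere_iff hqout).1 hq
  have ht : ∑ j ∈ K, G.vb j * G.supportShare K (G.slope K) j = G.slope K *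
      ((G.problem K).vaK - (G.problem K).vbK * G.bestParam K) := by
    rw [sum_vb_supportShare, bestParam]
    field_simp
    ring
  have hsq : ∑ j ∈ K, G.vb j * G.supportShare K (G.slope K) j ^ 2 = G.slope K ^ 2 *
      (G.problem K).A1 (G.bestParam K) := by
    rw [sum_vb_supportShare_sq, bestParam, UniProblem.A1]
    field_simp
    ring
  -- this sign selects the right one of the two roots
  have hsign : 0 ≤ G.xa * (G.slope K *
      ((G.problem K).vaK - (G.problem K).vbK * G.bestParam K)) -
        2 * G.xb * (G.problem K).vbKc := by
    have h1 : G.center * (G.problem K).vbK ≤ G.slope K *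
      ((G.problem K).vaK - (G.problem K).vbK * G.bestParam K) := by
      rw [← ht, sum_vb_supportShare]
      have := mul_pos hμ (problem_vaK_pos (G := G) hKn)
      linarith
    have hV := problem_vbK_pos (G := G) hKn
    have h2 : 2 * G.xb * (G.problem K).vbKc ≤ G.xa * (G.center * (G.problem K).vbK) := by
      rw [problem_B4] at hB
      have hN : 0 < G.xa + G.xb := by positivity
      have e : (2 * (G.xa + G.xb) * (G.problem K).vbK) *
          (G.xa * (G.center * (G.problem K).vbK) - 2 * G.xb * (G.problem K).vbKc) =
          G.xa ^ 2 * (G.problem K).vbK ^ 2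
            - 4 * G.xb * (G.xa + G.xb) * (G.problem K).vbK * (G.problem K).vbKc := by
        linear_combination G.xa * (G.problem K).vbK ^ 2 * two_mul_center (G := G)
      rw [← e] at hB
      linarith [(mul_pos_iff_of_pos_left (by positivity)).1 hB]
    have := mul_le_mul_of_nonneg_left h1 ha.le
    linarith
  rw [ht, hsq] at hL hs
  have h2 := problem_phi2 (G := G) (K := K) (G.bestParam K)
  have h1 := problem_phi1 (G := G) (K := K) (G.bestParam K)
  set T := (G.problem K).vaK - (G.problem K).vbK * G.bestParam K
  set A := (G.problem K).A1 (G.bestParam K) with hA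
  set v := (G.problem K).vbKc with hvdef
  set μ := G.slope K
  set L := G.multiplier (G.supportShare K μ)
  have hphi2 : (G.problem K).phi2 (G.bestParam K) =
      ((G.xa * (μ * T) - 2 * G.xb * v) / μ) ^ 2 := by
    rw [h2]
    field_simp
    linear_combination -4 * G.xb * v * hs
  refine ⟨by rw [hphi2]; positivity, ?_⟩
  rcases kind_cases hk with h | ⟨-, -, rfl, h⟩ | ⟨-, -, hKu, h⟩
  · exact absurd h.1 hK
  · have hy : (G.problem Finset.univ).yHat (G.bestParam Finset.univ) = A / G.xa := by
      unfold UniProblem.yHat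
      simp only [h]
      rfl
    have hv : v = 0 := by
      rw [hvdef]
      change ∑ j ∈ (Finset.univ)ᶜ, G.vb j = 0
      simp
    rw [hv] at hs
    rw [hy]
    refine mul_left_cancel₀ hb.ne' ?_
    rw [hL, show G.xb * (μ ^ 2 * (A / G.xa)) = G.xb * μ ^ 2 * A / G.xa by ring,
      div_eq_iff ha.ne']
    linear_combination hs
  · have hv : 0 < v := Finset.sum_pos (fun j _ => G.vb_pos j)
      (Finset.nonempty_iff_ne_empty.2 (by simpa using hKu))
    have hy : (G.problem K).yHat (G.bestParam K) = ((G.problem K).phi1 (G.bestParam K)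
        - T * √((G.problem K).phi2 (G.bestParam K))) / (2 * G.xb ^ 2 * v) := by
      unfold UniProblem.yHat
      simp only [h]
      rfl
    rw [hy, hphi2, Real.sqrt_sq (div_nonneg hsign hμ.le), h1]
    refine mul_left_cancel₀ hb.ne' ?_
    rw [hL]
    field_simp
    ring

/-- `bestParam` belongs to the optimal shares; by `yHat_bestParam`, it is these and not the second
intersection of the sphere with the line through `0` and the optimal shares. -/
lemma shareOf_bestParam [NeZero n] (hKn : K.Nonempty) (hK : ¬ G.UniformOn K)
    (hk : (G.problem K).kind ≠ .infeasible) (hB : 0 < (G.problem K).B4) :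
    G.shareOf K (G.bestParam K) = G.supportShare K (G.slope K) := by
  have hμ := slope_pos hKn hB
  have hb := G.xb_pos
  obtain ⟨h0, h1⟩ := yHat_bestParam hKn hK hk hB
  have hY := (yHat_spec hK hk h0).1
  have hA := problem_A1_pos hK (G.bestParam K)
  have hL := xb_mul_multiplier (G := G) (p := G.supportShare K (G.slope K)) (K := K)
    fun j hj => supportShare_of_notMem hj (G.slope K)
  rw [sum_vb_supportShare, sum_vb_supportShare_sq, ← h1] at hL
  have hD : ((G.problem K).vaK - (G.problem K).vbK * G.bestParam K) /
      ((G.problem K).yHat (G.bestParam K) * G.xb + (G.problem K).A1 (G.bestParam K)) =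
      G.slope K := by
    rw [div_eq_iff (by positivity)]
    refine mul_left_cancel₀ hμ.ne' ?_
    have e : G.slope K ^ 2 * (G.problem K).A1 (G.bestParam K) =
      G.center ^ 2 * (G.problem K).vbK + 2 * G.center * G.slope K * (G.problem K).vaK
      + G.slope K ^ 2 * (G.problem K).cK := by
      rw [UniProblem.A1, bestParam]
      field_simp
      ring
    have e' : G.slope K * ((G.problem K).vaK - (G.problem K).vbK * G.bestParam K) =
        G.center * (G.problem K).vbK + G.slope K * (G.problem K).vaK := by
      rw [bestParam]
      field_simp
      ring
    rw [e']
    linear_combination -hL - e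
  funext j
  by_cases hj : j ∈ K
  · rw [shareOf_of_mem hj, supportShare_of_mem hj, hD, bestParam]
    field_simp
    ring
  · rw [shareOf_of_notMem hj, supportShare_of_notMem hj]

/-- A maximizer `α` yields the unique best point of the sphere, and `α` can be read off from it
because the value ratios in `K` are not all equal. -/
lemma solutions_eq [NeZero n] (hKn : K.Nonempty) (hK : ¬ G.UniformOn K)
    (hk : (G.problem K).kind ≠ .infeasible) (hB : 0 < (G.problem K).B4) :
    (G.problem K).solutions = {G.bestParam K} := by
  have hμ := slope_pos hKn hB
  have hq := onSphere_supportShare_slope hKn hB.le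
  obtain ⟨h0, -⟩ := yHat_bestParam hKn hK hk hB
  have hbest := (onSphere_shareOf hK hk h0).2
  rw [shareOf_bestParam hKn hK hk hB] at hbest
  ext α
  rw [Set.mem_singleton_iff]
  constructor
  · rintro ⟨hα, hmax⟩
    obtain ⟨hs, hobj⟩ := onSphere_shareOf hK hk ((mem_domain_iff hk).1 hα)
    have h1 := hmax _ ((mem_domain_iff hk).2 h0)
    rw [hbest, hobj] at h1
    have h2 := (hq.sum_le_supportShare hμ.le hs fun j hj => shareOf_of_notMem hj α).2 h1
    -- two affine functions of the value ratio agree at two different ratios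
    have hK' : ∃ j ∈ K, ∃ h ∈ K, G.va j / G.vb j ≠ G.va h / G.vb h := by
      by_contra! hcon
      exact hK hcon
    obtain ⟨j, hj, h, hh, hne⟩ := hK'
    have e1 := congrFun h2 j
    have e2 := congrFun h2 h
    rw [shareOf_of_mem hj, supportShare_of_mem hj] at e1
    rw [shareOf_of_mem hh, supportShare_of_mem hh] at e2
    set t := ((G.problem K).vaK - (G.problem K).vbK * α) /
      ((G.problem K).yHat α * G.xb + (G.problem K).A1 α)
    have ht : t = G.slope K := by
      refine mul_right_cancel₀ (sub_ne_zero.2 hne) ?_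
      linear_combination e1 - e2
    rw [ht] at e1
    rw [bestParam, ← neg_eq_iff_eq_neg, eq_div_iff hμ.ne']
    linear_combination e1
  · rintro rfl
    refine ⟨(mem_domain_iff hk).2 h0, fun α hα => ?_⟩
    obtain ⟨hs, hobj⟩ := onSphere_shareOf hK hk ((mem_domain_iff hk).1 hα)
    rw [hbest, hobj]
    exact (hq.sum_le_supportShare hμ.le hs fun j hj => shareOf_of_notMem hj α).1

lemma sq_div_sqrt_sub (j : Fin n) (α : ℝ) :
    (G.va j / √(G.vb j) - α * √(G.vb j)) ^ 2 = G.vb j * (G.va j / G.vb j - α) ^ 2 := by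
  have hv := G.vb_pos j
  have hs := Real.sqrt_pos.2 hv
  have : G.va j / √(G.vb j) - α * √(G.vb j) = √(G.vb j) * (G.va j / G.vb j - α) := by
    have e := Real.mul_self_sqrt hv.le
    set s := √(G.vb j)
    rw [← e]
    field_simp
  rw [this, mul_pow, Real.sq_sqrt hv.le]

/-- Inside of `K`, the investment has the same form whether or not `K` consists of all
battlefields. -/
lemma insideInvestment_eq (hK : ¬ G.UniformOn K) (hk : (G.problem K).kind ≠ .infeasible)
    (α : ℝ) (j : Fin n) : G.insideInvestment K α j =
      G.vb j * (G.va j / G.vb j - α) ^ 2 / (G.problem K).yHat α := by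
  unfold insideInvestment UniProblem.yHat
  rcases kind_cases hk with h | ⟨-, -, rfl, h⟩ | ⟨-, -, hKu, h⟩
  · exact absurd h.1 hK
  · simp only [h, sq_div_sqrt_sub]
    rw [← problem_A1, div_div_eq_mul_div]
    rfl
  · simp only [h, sq_div_sqrt_sub]
    rw [div_div_eq_mul_div, mul_comm (G.vb j * _)]
    rfl

lemma commitment_bestParam [NeZero n] (hKn : K.Nonempty) (hK : ¬ G.UniformOn K)
    (hk : (G.problem K).kind ≠ .infeasible) (hB : 0 < (G.problem K).B4) :
    G.commitment K (G.bestParam K) = G.investment (G.supportShare K (G.slope K)) := by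
  have hμ := slope_pos hKn hB
  obtain ⟨h0, h1⟩ := yHat_bestParam hKn hK hk hB
  have hY := (yHat_spec hK hk h0).1
  refine commitment_eq_investment (onSphere_supportShare_slope hKn hB.le)
    (supportShare_pos hμ.le) (fun j hj => supportShare_of_notMem hj _) fun j hj => ?_
  rw [insideInvestment_eq hK hk, investment, ← h1, supportShare_of_mem hj, bestParam]
  field_simp
  ring

/-! ### The solutions of the univariate problem and the leader's problem -/

lemma solutions_nonempty [NeZero n] (hKn : K.Nonempty)
    (hk : (G.problem K).kind ≠ .infeasible) : (G.problem K).solutions.Nonempty := by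
  rcases kind_cases hk with ⟨hu, hB, h⟩ | ⟨hK, hB, -⟩ | ⟨hK, hB, -⟩
  · refine ⟨0, (mem_domain_iff hk).2 (hu.phi2_nonneg hKn hB 0), fun α _ => ?_⟩
    rw [(hu.commitment_eq hKn hB h α).2, (hu.commitment_eq hKn hB h 0).2]
  all_goals
    rw [solutions_eq hKn hK hk hB]
    exact Set.singleton_nonempty _

lemma commitment_of_mem_solutions [NeZero n] (hKn : K.Nonempty)
    (hk : (G.problem K).kind ≠ .infeasible) {α : ℝ} (hα : α ∈ (G.problem K).solutions) :
    G.commitment K α = G.investment (G.supportShare K (G.slope K)) ∧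
      (G.problem K).objective α = ∑ j ∈ K, G.va j * G.supportShare K (G.slope K) j := by
  rcases kind_cases hk with ⟨hu, hB, h⟩ | ⟨hK, hB, -⟩ | ⟨hK, hB, -⟩
  · exact hu.commitment_eq hKn hB h α
  all_goals
    rw [solutions_eq hKn hK hk hB, Set.mem_singleton_iff] at hα
    rw [hα]
    refine ⟨commitment_bestParam hKn hK hk hB, ?_⟩
    rw [(onSphere_shareOf hK hk (yHat_bestParam hKn hK hk hB).1).2,
      shareOf_bestParam hKn hK hk hB]

lemma candidates_eq [NeZero n] (hKn : K.Nonempty) (hk : (G.problem K).kind ≠ .infeasible) :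
    G.candidates K = {G.investment (G.supportShare K (G.slope K))} := by
  ext x
  rw [Set.mem_singleton_iff]
  constructor
  · rintro ⟨α, hα, rfl⟩
    exact (commitment_of_mem_solutions hKn hk hα).1
  · rintro rfl
    obtain ⟨α, hα⟩ := solutions_nonempty hKn hk
    exact ⟨α, hα, (commitment_of_mem_solutions hKn hk hα).1.symm⟩

lemma kind_ne_infeasible_of_mem_candidates {x : Fin n → ℝ} (hx : x ∈ G.candidates K) :
    (G.problem K).kind ≠ .infeasible := by
  obtain ⟨α, hα, -⟩ := hx
  exact hα.1.1

lemma hatU_commitment [NeZero n] (hKn : K.Nonempty) (hk : (G.problem K).kind ≠ .infeasible)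
    {α : ℝ} (hα : α ∈ (G.problem K).solutions) :
    (G.problem K).objective α = G.hatU K (G.commitment K α) := by
  obtain ⟨h1, h2⟩ := commitment_of_mem_solutions hKn hk hα
  rw [h1, h2, ((onSphere_supportShare_slope hKn (B4_nonneg_of_kind hk)).supportFeasible
    (supportShare_pos slope_nonneg) fun j hj => supportShare_of_notMem hj _).2]

lemma continuousOn_objective (hk : (G.problem K).kind ≠ .infeasible) :
    ContinuousOn (G.problem K).objective (G.problem K).domain := by
  have hcont : ¬ G.UniformOn K → (G.problem K).kind ≠ .uniform →
      Continuous (G.problem K).yHat →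
      ContinuousOn (G.problem K).objective (G.problem K).domain := by
    intro hK hu hy
    rw [show (G.problem K).objective = _ from funext (objective_of_ne_uniform hu)]
    refine ContinuousOn.div (by fun_prop) ?_ fun α hα => ?_
    · unfold UniProblem.A1
      fun_prop
    · have h1 := (yHat_spec hK hk hα.2).1
      have h2 := problem_A1_pos hK α
      have h3 : 0 < (G.problem K).xb := G.xb_pos
      positivity
  rcases kind_cases hk with ⟨-, -, h⟩ | ⟨hK, -, -, h⟩ | ⟨hK, -, -, h⟩
  · have : (G.problem K).objective = fun _ => (G.problem K).vaK * (G.problem K).uniformBudget /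
        ((G.problem K).xb + (G.problem K).uniformBudget) := by
      funext α
      unfold UniProblem.objective
      simp only [h]
    rw [this]
    exact continuousOn_const
  · refine hcont hK (by simp [h]) ?_
    have : (G.problem K).yHat = fun α => (G.problem K).A1 α / (G.problem K).xa := by
      funext α
      unfold UniProblem.yHat
      simp only [h]
    rw [this]
    unfold UniProblem.A1
    fun_prop
  · refine hcont hK (by simp [h]) ?_
    have : (G.problem K).yHat = fun α => ((G.problem K).phi1 α
        - ((G.problem K).vaK - (G.problem K).vbK * α) * √((G.problem K).phi2 α)) /
          (2 * (G.problem K).xb ^ 2 * (G.problem K).vbKc) := by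
      funext α
      unfold UniProblem.yHat
      simp only [h]
    rw [this]
    unfold UniProblem.phi1 UniProblem.phi2
    fun_prop

/-! ### The closed form for the full support -/

lemma univ_of_kind_eq_full (h : (G.problem K).kind = .full) :
    ¬ G.UniformOn K ∧ 0 < (G.problem K).B4 ∧ K = Finset.univ := by
  rcases kind_cases (G := G) (K := K) (by simp [h]) with h' | h' | h'
  · simp [h] at h'
  · exact ⟨h'.1, h'.2.1, h'.2.2.1⟩
  · simp [h] at h'

lemma bestParam_univ (hKn : (Finset.univ : Finset (Fin n)).Nonempty)
    (hB : 0 < (G.problem Finset.univ).B4) :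
    G.bestParam Finset.univ = -√((∑ h, G.va h ^ 2 / G.vb h) / ∑ h, G.vb h) := by
  have ha := G.xa_pos
  have hμ := slope_pos hKn hB
  have hV : 0 < ∑ h, G.vb h := problem_vbK_pos (G := G) hKn
  have hC : 0 < ∑ h, G.va h ^ 2 / G.vb h := problem_cK_pos (G := G) hKn
  have hv : (G.problem Finset.univ).vbKc = 0 := by
    change ∑ j ∈ (Finset.univ)ᶜ, G.vb j = 0
    simp
  have hB4 : (G.problem Finset.univ).B4 = G.xa ^ 2 * (∑ h, G.vb h) ^ 2 := by
    rw [problem_B4, hv, mul_zero, sub_zero]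
    rfl
  rw [bestParam, neg_inj, div_eq_iff hμ.ne', slope, hB4]
  change G.center = _ * (√(_ / ((∑ h, G.vb h) * ∑ h, G.va h ^ 2 / G.vb h)) / _)
  rw [← mul_div_assoc, ← Real.sqrt_mul (by positivity)]
  have e : (∑ h, G.va h ^ 2 / G.vb h) / (∑ h, G.vb h) * (G.xa ^ 2 * (∑ h, G.vb h) ^ 2 /
      ((∑ h, G.vb h) * ∑ h, G.va h ^ 2 / G.vb h)) = G.xa ^ 2 := by
    field_simp
  rw [e, Real.sqrt_sq ha.le, center]

/-- The closed form of the only maximizer and the only candidate for unequal value ratios and all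
battlefields in the support. -/
lemma full_closed_form [NeZero n] (h : (G.problem K).kind = .full) :
    (G.problem K).solutions = {-√((∑ h, G.va h ^ 2 / G.vb h) / ∑ h, G.vb h)} ∧
      G.candidates K =
        {fun j =>
          (G.va j / √(G.vb j) +
              √((∑ h, G.va h ^ 2 / G.vb h) / ∑ h, G.vb h) * √(G.vb j)) ^ 2 /
            (∑ l, (G.va l / √(G.vb l) +
              √((∑ h, G.va h ^ 2 / G.vb h) / ∑ h, G.vb h) * √(G.vb l)) ^ 2) * G.xa} := by
  obtain ⟨hK, hB, rfl⟩ := univ_of_kind_eq_full h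
  have hKn : (Finset.univ : Finset (Fin n)).Nonempty := ⟨0, Finset.mem_univ _⟩
  have hk : (G.problem Finset.univ).kind ≠ .infeasible := by simp [h]
  have hs := solutions_eq hKn hK hk hB
  rw [bestParam_univ hKn hB] at hs
  refine ⟨hs, ?_⟩
  ext x
  simp only [candidates, hs, Set.mem_singleton_iff, exists_eq_left, Set.mem_ofPred_eq]
  refine Eq.congr_right (funext fun j => ?_)
  unfold commitment insideInvestment
  simp only [Finset.mem_univ, if_true, h, neg_mul, sub_neg_eq_add]
  ring

/-! ### The support of the best response to the optimal commitment -/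

lemma cappedShare_lt_one_iff (hG : G.Sorted) [NeZero n] {μ : ℝ} (hμ : 0 ≤ μ)
    (hq : G.OnSphere (G.cappedShare μ)) :
    ∃ k : Fin n, ∀ j, G.cappedShare μ j < 1 ↔ j ∈ Finset.Iic k := by
  have hmono : ∀ i j, i ≤ j → G.cappedShare μ i ≤ G.cappedShare μ j := fun i j hij =>
    min_le_min_left _ (by linarith [mul_le_mul_of_nonneg_left (hG i j hij) hμ])
  have hne : (Finset.univ.filter fun j => G.cappedShare μ j < 1).Nonempty := by
    by_contra hcon
    rw [Finset.not_nonempty_iff_eq_empty, Finset.filter_eq_empty_iff] at hcon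
    have h1 : ∀ j, G.cappedShare μ j = 1 := fun j =>
      le_antisymm (cappedShare_le_one j) (not_lt.1 (hcon (Finset.mem_univ j)))
    unfold OnSphere at hq
    simp only [h1, one_pow, mul_one] at hq
    have hV : 0 < ∑ j, G.vb j := Finset.sum_pos (fun j _ => G.vb_pos j) ⟨0, Finset.mem_univ _⟩
    nlinarith [mul_pos G.xb_pos hV]
  refine ⟨Finset.max' _ hne, fun j => ⟨fun hj => ?_, fun hj => ?_⟩⟩
  · exact Finset.mem_Iic.2 (Finset.le_max' _ _ (by simpa using hj))
  · have := Finset.max'_mem _ hne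
    rw [Finset.mem_filter] at this
    exact (hmono _ _ (Finset.mem_Iic.1 hj)).trans_lt this.2

lemma cappedShare_eq_supportShare {μ : ℝ} (hK : ∀ j, G.cappedShare μ j < 1 ↔ j ∈ K) :
    G.cappedShare μ = G.supportShare K μ := by
  funext j
  by_cases hj : j ∈ K
  · rw [supportShare_of_mem hj]
    have h1 := (hK j).2 hj
    unfold cappedShare at h1 ⊢
    exact min_eq_right ((min_lt_iff.1 h1).resolve_left (lt_irrefl _)).le
  · rw [supportShare_of_notMem hj]
    exact le_antisymm (cappedShare_le_one j) (not_lt.1 fun h => hj ((hK j).1 h))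

lemma response_pos_iff [NeZero n] {p : Fin n → ℝ} (h : G.OnSphere p) (hp : ∀ j, 0 < p j)
    (j : Fin n) : 0 < G.response p j ↔ p j < 1 := by
  have hL := h.multiplier_pos hp
  unfold response
  rw [div_pos_iff_of_pos_right hL, mul_pos_iff_of_pos_left (mul_pos (G.vb_pos j) (hp j)), sub_pos]

/-- The best response to an optimal commitment has an initial segment as its support. -/
lemma IsOptimalCommitment.exists_support [NeZero n] (hG : G.Sorted) {x y : Fin n → ℝ}
    (hx : G.IsOptimalCommitment x) (hy : G.IsBestResponse x y) :
    ∃ k : Fin n, ∀ j, 0 < y j ↔ j ∈ Finset.Iic k := by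
  obtain ⟨μ, hμ, hq⟩ := exists_onSphere_cappedShare (G := G)
  have hpos := cappedShare_pos (G := G) hμ.le
  rw [isOptimalCommitment_iff hμ hq] at hx
  subst hx
  rw [(hq.bestResponse hpos fun j => cappedShare_le_one j).2 y hy]
  obtain ⟨k, hk⟩ := cappedShare_lt_one_iff hG hμ.le hq
  exact ⟨k, fun j => (response_pos_iff hq hpos j).trans (hk j)⟩

/-- The optimal commitment solves the leader's problem for the support of the best response. -/
lemma IsOptimalCommitment.eq_investment [NeZero n] (hKn : K.Nonempty) {x y : Fin n → ℝ}
    (hx : G.IsOptimalCommitment x) (hy : G.IsBestResponse x y)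
    (hK : ∀ j, 0 < y j ↔ j ∈ K) :
    (G.problem K).kind ≠ .infeasible ∧
      x = G.investment (G.supportShare K (G.slope K)) ∧
      G.leaderUtility x y =
        ∑ j ∈ K, G.va j * G.supportShare K (G.slope K) j + ∑ j ∈ Kᶜ, G.va j := by
  obtain ⟨μ, hμ, hq⟩ := exists_onSphere_cappedShare (G := G)
  have hpos := cappedShare_pos (G := G) hμ.le
  rw [isOptimalCommitment_iff hμ hq] at hx
  have hbr := hq.bestResponse hpos fun j => cappedShare_le_one j
  rw [hx] at hy
  have hyr := hbr.2 y hy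
  have hcap : G.cappedShare μ = G.supportShare K μ :=
    cappedShare_eq_supportShare fun j => by rw [← hK, hyr, response_pos_iff hq hpos]
  obtain ⟨hB, hs⟩ := OnSphere.slope_eq hKn hμ (hcap ▸ hq)
  refine ⟨kind_ne_infeasible hB, by rw [hx, hcap, hs], ?_⟩
  rw [hx, hyr, hq.leaderUtility_investment hpos, hcap, hs, ← Finset.sum_add_sum_compl K]
  congr 1
  exact Finset.sum_congr rfl fun j hj => by
    rw [supportShare_of_notMem (Finset.mem_compl.1 hj), mul_one]

lemma exists_isOptimalCommitment [NeZero n] : ∃ x, G.IsOptimalCommitment x := by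
  obtain ⟨μ, hμ, hq⟩ := exists_onSphere_cappedShare (G := G)
  exact ⟨_, (isOptimalCommitment_iff hμ hq _).2 rfl⟩

lemma isStrategy_of_mem_candidates [NeZero n] (hKn : K.Nonempty) {x : Fin n → ℝ}
    (hx : x ∈ G.candidates K) : IsStrategy G.xa x := by
  have hk := kind_ne_infeasible_of_mem_candidates hx
  rw [candidates_eq hKn hk, Set.mem_singleton_iff] at hx
  have h := ((onSphere_supportShare_slope hKn (B4_nonneg_of_kind hk)).supportFeasible
    (supportShare_pos slope_nonneg) fun j hj => supportShare_of_notMem hj _).1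
  rw [hx]
  exact ⟨fun j => (h.1 j).le, h.2.1⟩

/-- The optimal commitment is the best candidate. -/
lemma isOptimalCommitment_iff_candidates [NeZero n] (hG : G.Sorted) (x : Fin n → ℝ) :
    G.IsOptimalCommitment x ↔
      (∃ k : Fin n, x ∈ G.candidates (Finset.Iic k)) ∧
      ∃ y, G.IsBestResponse x y ∧
        ∀ (k' : Fin n) (x' y' : Fin n → ℝ), x' ∈ G.candidates (Finset.Iic k') →
          G.IsBestResponse x' y' → G.leaderUtility x' y' ≤ G.leaderUtility x y := by
  have hKn : ∀ k : Fin n, (Finset.Iic k).Nonempty := fun k => ⟨k, Finset.mem_Iic.2 le_rfl⟩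
  have hmem : ∀ {x}, G.IsOptimalCommitment x → ∃ k : Fin n, x ∈ G.candidates (Finset.Iic k) := by
    intro x hx
    obtain ⟨y, hy, -⟩ := hx.2
    obtain ⟨k, hk⟩ := hx.exists_support hG hy
    obtain ⟨h1, h2, -⟩ := hx.eq_investment (hKn k) hy hk
    exact ⟨k, by rw [candidates_eq (hKn k) h1, Set.mem_singleton_iff, h2]⟩
  constructor
  · intro hx
    obtain ⟨y, hy, hbest⟩ := hx.2
    exact ⟨hmem hx, y, hy, fun k' x' y' hx' hy' =>
      hbest x' y' (isStrategy_of_mem_candidates (hKn k') hx') hy'⟩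
  · rintro ⟨⟨k, hk⟩, y, hy, hbest⟩
    obtain ⟨x₀, h₀⟩ := exists_isOptimalCommitment (G := G)
    obtain ⟨k₀, hk₀⟩ := hmem h₀
    obtain ⟨y₀, hy₀, hbest₀⟩ := h₀.2
    exact ⟨isStrategy_of_mem_candidates (hKn k) hk, y, hy, fun x' y' hx' hy' =>
      (hbest₀ x' y' hx' hy').trans (hbest k₀ x₀ y₀ hk₀ hy₀)⟩

end Game

/-! ### Executions of programs -/

/-- A bound on the time of a program without nested loops: the program takes at most
`p.cost * n` steps if `n` is positive and each of its loops is repeated at most `n` times. -/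
def Prog.cost : Prog → ℕ
  | .instr _ => 1
  | .seq p q => p.cost + q.cost
  | .ite _ p q => p.cost + q.cost + 1
  | .loop _ p => p.cost + 2

/-- Started in state `s`, the program `p` halts after at most `p.cost * n` steps in a state that
satisfies `Q`. -/
def Runs (n : ℕ) (p : Prog) (s : RamState) (Q : RamState → Prop) : Prop :=
  ∃ m ≤ p.cost * n, ∃ s', Exec p s m s' ∧ Q s'

namespace Runs

variable {n : ℕ} {p q : Prog} {s : RamState} {Q Q' : RamState → Prop}

lemma mono (h : Runs n p s Q) (hQ : ∀ s, Q s → Q' s) : Runs n p s Q' := by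
  obtain ⟨m, hm, s', he, hs⟩ := h
  exact ⟨m, hm, s', he, hQ s' hs⟩

lemma instr (hn : 0 < n) {c : Instr} (h : Q (c.apply s)) : Runs n (.instr c) s Q :=
  ⟨1, by rw [Prog.cost, one_mul]; exact hn, _, .instr c s, h⟩

lemma seq (h : Runs n p s fun s' => Runs n q s' Q) : Runs n (.seq p q) s Q := by
  obtain ⟨m, hm, s', he, m', hm', s'', he', hs⟩ := h
  exact ⟨m + m', by simpa [Prog.cost, add_mul] using add_le_add hm hm', s'', .seq he he', hs⟩

lemma ite (hn : 0 < n) {t : Test} (h₁ : t.Holds s → Runs n p s Q)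
    (h₂ : ¬ t.Holds s → Runs n q s Q) : Runs n (.ite t p q) s Q := by
  by_cases ht : t.Holds s
  · obtain ⟨m, hm, s', he, hs⟩ := h₁ ht
    refine ⟨m + 1, ?_, s', .iteTrue ht he, hs⟩
    simp only [Prog.cost, add_mul]
    omega
  · obtain ⟨m, hm, s', he, hs⟩ := h₂ ht
    refine ⟨m + 1, ?_, s', .iteFalse ht he, hs⟩
    simp only [Prog.cost, add_mul]
    omega

/-- The rule for loops that are repeated `N` times, with an invariant `I`. -/
lemma loop {t : Test} {N : ℕ} (hN : N ≤ n) (hn : 0 < n) (I : ℕ → RamState → Prop)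
    (hstep : ∀ i < N, ∀ s, I i s → t.Holds s ∧ Runs 1 p s (I (i + 1)))
    (hend : ∀ s, I N s → ¬ t.Holds s) (h0 : I 0 s) : Runs n (.loop t p) s (I N) := by
  have key : ∀ d i, i + d = N → ∀ s, I i s →
      ∃ m ≤ d * (p.cost + 1) + 1, ∃ s', Exec (.loop t p) s m s' ∧ I N s' := by
    intro d
    induction d with
    | zero =>
      intro i hi s hs
      obtain rfl : i = N := hi
      exact ⟨1, by omega, s, .loopFalse (hend s hs), hs⟩
    | succ d ih =>
      intro i hi s hs
      obtain ⟨ht, m, hm, s', he, hs'⟩ := hstep i (by omega) s hs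
      obtain ⟨m', hm', s'', he', hs''⟩ := ih (i + 1) (by omega) s' hs'
      refine ⟨m + m' + 1, ?_, s'', .loopTrue ht he he', hs''⟩
      rw [add_mul]
      omega
  obtain ⟨m, hm, s', he, hs⟩ := key N 0 (zero_add N) s h0
  refine ⟨m, hm.trans ?_, s', he, hs⟩
  have := Nat.mul_le_mul_right (p.cost + 1) hN
  simp only [Prog.cost, add_mul, mul_add, mul_comm n] at *
  omega

end Runs

/-! ### Arithmetic expressions -/

/-- Arithmetic expressions over real registers and array entries; in `entry a i` the index is in the
natural number register `i`. -/
inductive RExpr where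
  | reg (r : ℕ)
  | entry (a i : ℕ)
  | const (c : ℤ)
  | bin (op : ArithOp) (e f : RExpr)
  | sqrt (e : RExpr)

namespace RExpr

instance : Add RExpr := ⟨bin .add⟩
instance : Sub RExpr := ⟨bin .sub⟩
instance : Mul RExpr := ⟨bin .mul⟩
instance : Div RExpr := ⟨bin .div⟩

noncomputable def eval (s : RamState) : RExpr → ℝ
  | reg r => s.real r
  | entry a i => s.arr a (s.nat i)
  | const c => c
  | bin op e f => op.eval (e.eval s) (f.eval s)
  | sqrt e => √(e.eval s)

@[simp] lemma eval_reg (s : RamState) (r : ℕ) : (reg r).eval s = s.real r := rfl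
@[simp] lemma eval_entry (s : RamState) (a i : ℕ) : (entry a i).eval s = s.arr a (s.nat i) := rfl
@[simp] lemma eval_const (s : RamState) (c : ℤ) : (const c).eval s = c := rfl
@[simp] lemma eval_add (s : RamState) (e f : RExpr) : (e + f).eval s = e.eval s + f.eval s := rfl
@[simp] lemma eval_sub (s : RamState) (e f : RExpr) : (e - f).eval s = e.eval s - f.eval s := rfl
@[simp] lemma eval_mul (s : RamState) (e f : RExpr) : (e * f).eval s = e.eval s * f.eval s := rfl
@[simp] lemma eval_div (s : RamState) (e f : RExpr) : (e / f).eval s = e.eval s / f.eval s := rfl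
@[simp] lemma eval_sqrt (s : RamState) (e : RExpr) : (sqrt e).eval s = √(e.eval s) := rfl

/-- All registers in the expression are below `d`. -/
def Below (d : ℕ) : RExpr → Prop
  | reg r => r < d
  | entry _ _ => True
  | const _ => True
  | bin _ e f => e.Below d ∧ f.Below d
  | sqrt e => e.Below d

instance decidableBelow (d : ℕ) : (e : RExpr) → Decidable (e.Below d)
  | reg r => inferInstanceAs (Decidable (r < d))
  | entry _ _ => inferInstanceAs (Decidable True)
  | const _ => inferInstanceAs (Decidable True)
  | bin _ e f => @instDecidableAnd _ _ (decidableBelow d e) (decidableBelow d f)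
  | sqrt e => decidableBelow d e

lemma Below.mono {d d' : ℕ} (hd : d ≤ d') : {e : RExpr} → e.Below d → e.Below d'
  | reg _, h => lt_of_lt_of_le h hd
  | entry _ _, _ => trivial
  | const _, _ => trivial
  | bin _ _ _, h => ⟨h.1.mono hd, h.2.mono hd⟩
  | sqrt e, h => Below.mono (e := e) hd h

/-- A program that computes `e` into the real register `d`, with registers from `d` on as scratch
space. -/
def compile : RExpr → ℕ → Prog
  | reg r, d => .seq (.instr (.realConst d 0)) (.instr (.arith d .add r d))
  | entry a i, d => .instr (.load d a i)
  | const c, d => .instr (.realConst d c)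
  | bin op e f, d =>
      .seq (e.compile d) (.seq (f.compile (d + 1)) (.instr (.arith d op d (d + 1))))
  | sqrt e, d => .seq (e.compile d) (.instr (.sqrt d d))

end RExpr

/-- The states `s` and `s'` agree, except for real registers from `d` on. -/
def RamState.Agree (d : ℕ) (s s' : RamState) : Prop :=
  s.nat = s'.nat ∧ s.arr = s'.arr ∧ ∀ r < d, s.real r = s'.real r

lemma RExpr.eval_congr {d : ℕ} {s s' : RamState} (h : s.Agree d s') :
    {e : RExpr} → e.Below d → e.eval s = e.eval s'
  | reg r, hr => h.2.2 r hr
  | entry a i, _ => by simp [h.1, h.2.1]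
  | const _, _ => rfl
  | bin op e f, he => by
    have h1 := RExpr.eval_congr h (e := e) he.1
    have h2 := RExpr.eval_congr h (e := f) he.2
    simp only [eval, h1, h2]
  | sqrt e, he => by
    have h1 := RExpr.eval_congr h (e := e) he
    simp only [eval, h1]

lemma RExpr.runs_compile {n : ℕ} (hn : 0 < n) (e : RExpr) :
    ∀ (d : ℕ) (s : RamState), e.Below d →
      Runs n (e.compile d) s fun s' => s'.Agree d s ∧ s'.real d = e.eval s := by
  induction e with
  | reg r =>
    intro d s hr
    refine Runs.seq (Runs.instr hn (Runs.instr hn ⟨⟨rfl, rfl, fun r' hr' => ?_⟩, ?_⟩))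
    · simp [Instr.apply, hr'.ne]
    · simp [Instr.apply, ArithOp.eval, (show r < d from hr).ne]
  | entry a i =>
    intro d s _
    refine Runs.instr hn ⟨⟨rfl, rfl, fun r' hr' => ?_⟩, ?_⟩
    · simp [Instr.apply, hr'.ne]
    · simp [Instr.apply]
  | const c =>
    intro d s _
    refine Runs.instr hn ⟨⟨rfl, rfl, fun r' hr' => ?_⟩, ?_⟩
    · simp [Instr.apply, hr'.ne]
    · simp [Instr.apply]
  | bin op e f he hf =>
    intro d s hb
    refine Runs.seq ((he d s hb.1).mono fun s₁ h₁ => Runs.seq ?_)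
    refine (hf (d + 1) s₁ (hb.2.mono d.le_succ)).mono fun s₂ h₂ =>
      Runs.instr hn ⟨⟨?_, ?_, fun r' hr' => ?_⟩, ?_⟩
    · exact h₂.1.1.trans h₁.1.1
    · exact h₂.1.2.1.trans h₁.1.2.1
    · have := (h₂.1.2.2 r' (by omega)).trans (h₁.1.2.2 r' hr')
      simpa [Instr.apply, hr'.ne] using this
    · simp only [Instr.apply, Function.update_self, h₂.2, h₂.1.2.2 d d.lt_succ_self, h₁.2,
        RExpr.eval, RExpr.eval_congr h₁.1 hb.2]
  | sqrt e he =>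
    intro d s hb
    refine Runs.seq ((he d s hb).mono fun s₁ h₁ =>
      Runs.instr hn ⟨⟨h₁.1.1, h₁.1.2.1, fun r' hr' => ?_⟩, ?_⟩)
    · simpa [Instr.apply, hr'.ne] using h₁.1.2.2 r' hr'
    · simp only [Instr.apply, Function.update_self, h₁.2, RExpr.eval]

/-! ### Blocks of assignments -/

/-- The real registers from this one on are scratch space. -/
def scratch : ℕ := 20

/-- A program that assigns the values of expressions to real registers, one after the other. -/
def assign : List (ℕ × RExpr) → Prog
  | [] => .instr (.realConst scratch 0)
  | (t, e) :: l => .seq (.seq (e.compile scratch)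
      (.seq (.instr (.realConst t 0)) (.instr (.arith t .add t scratch)))) (assign l)

/-- The effect of `assign` on the real registers below `scratch`. -/
noncomputable def assigned : List (ℕ × RExpr) → RamState → RamState
  | [], s => s
  | (t, e) :: l, s => assigned l { s with real := Function.update s.real t (e.eval s) }

lemma assigned_real_of_ne (l : List (ℕ × RExpr)) {r : ℕ} (hr : ∀ a ∈ l, a.1 ≠ r) :
    ∀ s : RamState, (assigned l s).real r = s.real r := by
  induction l with
  | nil => exact fun s => rfl
  | cons a l ih =>
    intro s
    have ha := hr a (by simp)
    refine (ih (fun b hb => hr b (by simp [hb])) _).trans ?_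
    simp [ha.symm]

lemma assigned_nat (l : List (ℕ × RExpr)) : ∀ s : RamState, (assigned l s).nat = s.nat := by
  induction l with
  | nil => exact fun s => rfl
  | cons a l ih => exact fun s => ih _

lemma assigned_arr (l : List (ℕ × RExpr)) : ∀ s : RamState, (assigned l s).arr = s.arr := by
  induction l with
  | nil => exact fun s => rfl
  | cons a l ih => exact fun s => ih _

/-- The targets of the assignments and the registers in the expressions are below `scratch`. -/
def AssignBelow (l : List (ℕ × RExpr)) : Prop := ∀ a ∈ l, a.1 < scratch ∧ a.2.Below scratch

instance (l : List (ℕ × RExpr)) : Decidable (AssignBelow l) :=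
  inferInstanceAs (Decidable (∀ a ∈ l, a.1 < scratch ∧ a.2.Below scratch))

lemma assigned_congr (l : List (ℕ × RExpr)) (hl : AssignBelow l) :
    ∀ {s s' : RamState}, s.Agree scratch s' → (assigned l s).Agree scratch (assigned l s') := by
  induction l with
  | nil => exact fun h => h
  | cons a l ih =>
    intro s s' h
    have ha := hl a (by simp)
    refine ih (fun b hb => hl b (by simp [hb])) ⟨h.1, h.2.1, fun r hr => ?_⟩
    by_cases hra : r = a.1
    · subst hra
      simp [RExpr.eval_congr h ha.2]
    · simp [hra, h.2.2 r hr]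

lemma runs_assign {n : ℕ} (hn : 0 < n) {l : List (ℕ × RExpr)} (hl : AssignBelow l) :
    ∀ {s : RamState} {Q : RamState → Prop},
      (∀ s', s'.Agree scratch (assigned l s) → Q s') → Runs n (assign l) s Q := by
  induction l with
  | nil =>
    intro s Q h
    refine Runs.instr hn (h _ ⟨rfl, rfl, fun r hr => ?_⟩)
    simp [Instr.apply, assigned, hr.ne]
  | cons a l ih =>
    intro s Q h
    have ha := hl a (by simp)
    have hl' : AssignBelow l := fun b hb => hl b (by simp [hb])
    refine Runs.seq (Runs.seq ((a.2.runs_compile hn scratch s ha.2).mono fun s₁ h₁ =>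
      Runs.seq (Runs.instr hn (Runs.instr hn (ih hl' fun s' hs' => h s' ?_)))))
    have h2 := assigned_congr l hl' (s := (Instr.arith a.1 .add a.1 scratch).apply
      ((Instr.realConst a.1 0).apply s₁))
      (s' := { s with real := Function.update s.real a.1 (a.2.eval s) }) ⟨h₁.1.1, h₁.1.2.1,
        fun r hr => ?_⟩
    · exact ⟨hs'.1.trans h2.1, hs'.2.1.trans h2.2.1,
        fun r hr => (hs'.2.2 r hr).trans (h2.2.2 r hr)⟩
    · by_cases hra : r = a.1
      · subst hra
        simp [Instr.apply, ArithOp.eval, ha.1.ne', h₁.2]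
      · simp [Instr.apply, hra, h₁.1.2.2 r hr]

/-! ### The formulation program -/

section Programs

open RExpr Prog Instr

/-- One step of the summation over `K`: adds up the values, with the index in the natural number
register `2`. -/
def sumInside : Prog :=
  .seq (assign [(14, entry 0 2), (15, entry 1 2), (4, reg 4 + reg 14), (5, reg 5 + reg 15),
    (7, reg 7 + reg 14 * reg 14 / reg 15), (16, reg 14 / reg 15)]) (.instr (natSucc 2))

/-- One step of the summation over the complement of `K`. -/
def sumOutside : Prog :=
  .seq (assign [(6, reg 6 + entry 1 2)]) (.instr (natSucc 2))

/-- Saves the number of battlefields and the parameter `α`, moves the budgets to their final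
registers, and clears the accumulators. -/
def formulateInit : Prog :=
  .seq (.instr (natCopy 3 0)) (.seq (.instr (natConst 2 0))
    (assign [(19, reg 2), (2, reg 0), (3, reg 1), (4, const 0), (5, const 0), (6, const 0),
      (7, const 0), (17, entry 0 2 / entry 1 2)]))

/-- Sums over `K` into the real registers `4`, `5`, `7` and over its complement into the real
register `6`; the real registers `16` and `17` hold the last and the first value ratio in `K`. -/
def formulateSums : Prog :=
  .seq (.loop (.natLt 2 1) sumInside) (.loop (.natLt 2 3) sumOutside)

/-- Computes `B1`, …, `B6`, and from them the end points of the domain, which overwrite the budgets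
in the real registers `0` and `1`. -/
def formulateCoeffs : Prog :=
  .seq (assign
    [(8, reg 2 * (reg 5 * reg 5) - const 2 * reg 3 * reg 5 * reg 6),
     (9, const 4 * reg 3 * reg 4 * reg 6 - const 2 * reg 2 * reg 4 * reg 5),
     (10, reg 2 * (reg 4 * reg 4) - const 2 * reg 3 * reg 6 * reg 7),
     (11, reg 2 * reg 2 * (reg 5 * reg 5) - const 4 * reg 3 * (reg 2 + reg 3) * reg 5 * reg 6),
     (12, const 8 * reg 3 * (reg 2 + reg 3) * reg 4 * reg 6
        - const 2 * (reg 2 * reg 2) * reg 4 * reg 5),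
     (13, reg 2 * reg 2 * (reg 4 * reg 4) - const 4 * reg 3 * (reg 2 + reg 3) * reg 7 * reg 6)])
    (assign
    [(0, (const 0 - reg 12 - sqrt (reg 12 * reg 12 - const 4 * reg 11 * reg 13))
        / (const 2 * reg 11)),
     (1, (const 0 - reg 12 + sqrt (reg 12 * reg 12 - const 4 * reg 11 * reg 13))
        / (const 2 * reg 11)),
     (18, const 0)])

/-- Sets the kind of the problem.  By the ordering of the battlefields, the value ratios in `K` are
equal if the last one is at most the first one. -/
def formulateKind : Prog :=
  .ite (.realLe 16 17)
    (.ite (.realLe 18 11) (.instr (natConst 0 1)) (.instr (natConst 0 0)))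
    (.ite (.realLe 11 18) (.instr (natConst 0 0))
      (.ite (.natLt 1 0) (.instr (natConst 0 3)) (.instr (natConst 0 2))))

/-- The program that formulates the univariate problem. -/
def formulate : Prog :=
  .seq formulateInit (.seq formulateSums (.seq formulateCoeffs formulateKind))

end Programs

namespace Game

variable {n : ℕ} {G : Game n}

variable (G) in
/-- The leader's values as an array. -/
noncomputable def arrA (i : ℕ) : ℝ := if h : i < n then G.va ⟨i, h⟩ else 0

variable (G) in
/-- The follower's values as an array. -/
noncomputable def arrB (i : ℕ) : ℝ := if h : i < n then G.vb ⟨i, h⟩ else 0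

lemma arrA_val (j : Fin n) : G.arrA j = G.va j := by simp [arrA]

lemma arrB_val (j : Fin n) : G.arrB j = G.vb j := by simp [arrB]

lemma sum_Iic_eq (k : Fin n) {f : Fin n → ℝ} {g : ℕ → ℝ} (h : ∀ j : Fin n, g j = f j) :
    ∑ j ∈ Finset.Iic k, f j = ∑ i ∈ Finset.range (k + 1), g i := by
  rw [Nat.range_succ_eq_Iic, ← Fin.map_valEmbedding_Iic, Finset.sum_map]
  exact Finset.sum_congr rfl fun j _ => (h j).symm

lemma sum_compl_Iic_eq (k : Fin n) {f : Fin n → ℝ} {g : ℕ → ℝ} (h : ∀ j : Fin n, g j = f j) :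
    ∑ j ∈ (Finset.Iic k)ᶜ, f j = ∑ i ∈ Finset.Ico ((k : ℕ) + 1) n, g i := by
  have h1 := Finset.sum_add_sum_compl (Finset.Iic k) f
  have h2 : ∑ i ∈ Finset.range n, g i = ∑ j, f j := by
    rw [Finset.sum_range]
    exact Finset.sum_congr rfl fun j _ => h j
  rw [sum_Iic_eq k h, ← h2, ← Finset.sum_range_add_sum_Ico g k.2] at h1
  exact add_left_cancel h1

/-- The part of the memory that stays constant during the whole computation; natural number register
`3` and real register `19` are the saved copies of `n` and `α`. -/
def Fixed (G : Game n) (k : Fin n) (α : ℝ) (s : RamState) : Prop :=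
  s.nat 1 = k + 1 ∧ s.nat 3 = n ∧ s.arr 0 = G.arrA ∧ s.arr 1 = G.arrB ∧ s.real 19 = α

/-- The memory while the sums are computed: the first `i` battlefields have been added to the sums
over `K`, and the battlefields from `k + 1` to `o - 1` to the sum over the complement. -/
def Summing (G : Game n) (k : Fin n) (α : ℝ) (i o : ℕ) (s : RamState) : Prop :=
  G.Fixed k α s ∧ s.nat 0 = n ∧ s.real 2 = G.xa ∧ s.real 3 = G.xb ∧
    s.real 4 = ∑ l ∈ Finset.range i, G.arrA l ∧
    s.real 5 = ∑ l ∈ Finset.range i, G.arrB l ∧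
    s.real 6 = ∑ l ∈ Finset.Ico ((k : ℕ) + 1) o, G.arrB l ∧
    s.real 7 = ∑ l ∈ Finset.range i, G.arrA l ^ 2 / G.arrB l ∧
    (0 < i → s.real 16 = G.arrA (i - 1) / G.arrB (i - 1)) ∧
    s.real 17 = G.arrA 0 / G.arrB 0

lemma runs_formulateInit (hn : 0 < n) (k : Fin n) (α : ℝ) :
    Runs n formulateInit (G.input (k + 1) α)
      fun s => G.Summing k α 0 (k + 1) s ∧ s.nat 2 = 0 := by
  refine Runs.seq (Runs.instr hn (Runs.seq (Runs.instr hn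
    (runs_assign hn (by decide) fun s ⟨h1, h2, h3⟩ => ?_))))
  have ha : (G.input (k + 1) α).arr 0 = G.arrA := by
    funext i
    simp [input, arrA]
  have hb : (G.input (k + 1) α).arr 1 = G.arrB := by
    funext i
    simp [input, arrB]
  have hr : ∀ r < 20, s.real r = _ := h3
  refine ⟨⟨⟨?_, ?_, ?_, ?_, ?_⟩, ?_, ?_, ?_, ?_, ?_, ?_, ?_, ?_, ?_⟩, ?_⟩
  all_goals first
    | rw [hr _ (by norm_num)]
    | rw [h1]
    | rw [h2]
  all_goals simp [assigned, Instr.apply, ha, hb]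
  all_goals simp [input]

lemma runs_formulateSums (hn : 0 < n) (k : Fin n) (α : ℝ) {s : RamState}
    (hs : G.Summing k α 0 (k + 1) s) (hs2 : s.nat 2 = 0) :
    Runs n formulateSums s (G.Summing k α (k + 1) n) := by
  refine Runs.seq ((Runs.loop (N := k + 1) (by omega) hn
    (fun i s => G.Summing k α i (k + 1) s ∧ s.nat 2 = i) ?_ ?_ ⟨hs, hs2⟩).mono ?_)
  · rintro i hi s ⟨⟨⟨h1, h3, ha, hb, h19⟩, h0, hr2, hr3, hr4, hr5, hr6, hr7, hr16, hr17⟩, h2⟩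
    refine ⟨by simpa [Test.Holds, h1, h2] using hi, Runs.seq (runs_assign one_pos (by decide)
      fun s' ⟨e1, e2, e3⟩ => Runs.instr one_pos ?_)⟩
    have hr : ∀ r < 20, s'.real r = _ := e3
    refine ⟨⟨⟨?_, ?_, ?_, ?_, ?_⟩, ?_, ?_, ?_, ?_, ?_, ?_, ?_, fun _ => ?_, ?_⟩, ?_⟩
    all_goals simp only [Instr.apply]
    all_goals first
      | rw [hr _ (by norm_num)]
      | rw [e1]
      | rw [e2]
    all_goals simp [assigned, *, Finset.sum_range_succ, sq]
  · rintro s ⟨⟨⟨h1, -⟩, -⟩, h2⟩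
    simp [Test.Holds, h1, h2]
  · rintro s ⟨hs, hs2⟩
    have hmono : ∀ s, G.Summing k α (k + 1) (k + 1 + (n - (k + 1))) s ∧
        s.nat 2 = k + 1 + (n - (k + 1)) → G.Summing k α (k + 1) n s := by
      intro s h
      rw [Nat.add_sub_cancel' k.2] at h
      exact h.1
    refine (Runs.loop (N := n - (k + 1)) (by omega) hn
      (fun i s => G.Summing k α (k + 1) (k + 1 + i) s ∧ s.nat 2 = k + 1 + i)
      ?_ ?_ ⟨hs, hs2⟩).mono hmono
    · rintro i hi s ⟨⟨⟨h1, h3, ha, hb, h19⟩, h0, hr2, hr3, hr4, hr5, hr6, hr7, hr16, hr17⟩, h2⟩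
      refine ⟨by simp only [Test.Holds, h2, h3]; omega,
        Runs.seq (runs_assign one_pos (by decide)
          fun s' ⟨e1, e2, e3⟩ => Runs.instr one_pos ?_)⟩
      have hsum : ∑ l ∈ Finset.Ico ((k : ℕ) + 1) (k + 1 + i + 1), G.arrB l = _ :=
        Finset.sum_Ico_succ_top (by omega) _
      have hr : ∀ r < 20, s'.real r = _ := e3
      refine ⟨⟨⟨?_, ?_, ?_, ?_, ?_⟩, ?_, ?_, ?_, ?_, ?_, ?_, ?_, fun _ => ?_, ?_⟩, ?_⟩
      all_goals simp only [Instr.apply]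
      all_goals first
        | rw [hr _ (by norm_num)]
        | rw [e1]
        | rw [e2]
      all_goals simp [assigned, ← add_assoc, *]
    · rintro s ⟨⟨⟨h1, h3, -⟩, -⟩, h2⟩
      simp only [Test.Holds, h2, h3]
      omega

lemma uniformOn_Iic_iff (hG : G.Sorted) (k : Fin n) :
    G.UniformOn (Finset.Iic k) ↔
      G.arrA (k + 1 - 1) / G.arrB (k + 1 - 1) ≤ G.arrA 0 / G.arrB 0 := by
  have hn : 0 < n := k.pos
  have e0 : G.arrA 0 / G.arrB 0 = G.va ⟨0, hn⟩ / G.vb ⟨0, hn⟩ := by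
    simp [arrA, arrB, hn]
  rw [Nat.add_sub_cancel, arrA_val, arrB_val, e0]
  constructor
  · intro h
    exact (h k (Finset.mem_Iic.2 le_rfl) _ (Finset.mem_Iic.2 (Nat.zero_le _))).le
  · intro h
    have key : ∀ j ∈ Finset.Iic k, G.va j / G.vb j = G.va k / G.vb k := fun j hj =>
      le_antisymm (hG j k (Finset.mem_Iic.1 hj)) (h.trans (hG _ j (Nat.zero_le _)))
    exact fun j hj i hi => (key j hj).trans (key i hi).symm

lemma Iic_eq_univ_iff (k : Fin n) : Finset.Iic k = Finset.univ ↔ ¬ (k : ℕ) + 1 < n := by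
  constructor
  · intro h hlt
    have : (⟨k + 1, hlt⟩ : Fin n) ∈ Finset.Iic k := h ▸ Finset.mem_univ _
    rw [Finset.mem_Iic, Fin.le_def] at this
    simp at this
  · intro h
    refine Finset.eq_univ_of_forall fun j => Finset.mem_Iic.2 ?_
    rw [Fin.le_def]
    omega

/-- The memory after the coefficients have been computed, up to the kind of the problem. -/
def HoldsCoeffs (G : Game n) (k : Fin n) (α : ℝ) (s : RamState) : Prop :=
  G.Fixed k α s ∧ ∀ i : Fin (G.problem (Finset.Iic k)).coeffs.length,
    s.real i = (G.problem (Finset.Iic k)).coeffs.get i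

lemma runs_formulateCoeffs (hn : 0 < n) (k : Fin n) (α : ℝ) {s : RamState}
    (hs : G.Summing k α (k + 1) n s) :
    Runs n formulateCoeffs s fun s => G.HoldsCoeffs k α s ∧ s.nat 0 = n ∧ s.real 18 = 0 ∧
      s.real 16 = G.arrA (k + 1 - 1) / G.arrB (k + 1 - 1) ∧
      s.real 17 = G.arrA 0 / G.arrB 0 := by
  obtain ⟨⟨h1, h3, ha, hb, h19⟩, h0, hr2, hr3, hr4, hr5, hr6, hr7, hr16, hr17⟩ := hs
  have hr16 := hr16 k.val.succ_pos
  have f4 : (G.problem (Finset.Iic k)).vaK = s.real 4 := by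
    rw [hr4]
    exact sum_Iic_eq k arrA_val
  have f5 : (G.problem (Finset.Iic k)).vbK = s.real 5 := by
    rw [hr5]
    exact sum_Iic_eq k arrB_val
  have f6 : (G.problem (Finset.Iic k)).vbKc = s.real 6 := by
    rw [hr6]
    exact sum_compl_Iic_eq k arrB_val
  have f7 : (G.problem (Finset.Iic k)).cK = s.real 7 := by
    rw [hr7]
    exact sum_Iic_eq k fun j => by rw [arrA_val, arrB_val]
  refine Runs.seq (runs_assign hn (by decide) fun s' ⟨e1, e2, e3⟩ =>
    runs_assign hn (by decide) fun s'' ⟨e1', e2', e3'⟩ => ?_)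
  have hr : ∀ r < 20, s'.real r = _ := e3
  have hr' : ∀ r < 20, s''.real r = _ := e3'
  have g : ∀ r, 2 ≤ r → r ≤ 7 → s'.real r = s.real r := by
    intro r h2 h7
    rw [hr r (by omega), assigned_real_of_ne _ (by simp; omega)]
  have g8 : s'.real 8 = (G.problem (Finset.Iic k)).B1 := by
    change _ = G.xa * (G.problem (Finset.Iic k)).vbK ^ 2
      - 2 * G.xb * (G.problem (Finset.Iic k)).vbK * (G.problem (Finset.Iic k)).vbKc
    rw [hr 8 (by norm_num), f5, f6, ← hr2, ← hr3]
    simp [assigned, sq]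
  have g9 : s'.real 9 = (G.problem (Finset.Iic k)).B2 := by
    change _ = 4 * G.xb * (G.problem (Finset.Iic k)).vaK * (G.problem (Finset.Iic k)).vbKc
      - 2 * G.xa * (G.problem (Finset.Iic k)).vaK * (G.problem (Finset.Iic k)).vbK
    rw [hr 9 (by norm_num), f4, f5, f6, ← hr2, ← hr3]
    simp [assigned]
  have g10 : s'.real 10 = (G.problem (Finset.Iic k)).B3 := by
    change _ = G.xa * (G.problem (Finset.Iic k)).vaK ^ 2
      - 2 * G.xb * (G.problem (Finset.Iic k)).vbKc * (G.problem (Finset.Iic k)).cK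
    rw [hr 10 (by norm_num), f4, f6, f7, ← hr2, ← hr3]
    simp [assigned, sq]
  have g11 : s'.real 11 = (G.problem (Finset.Iic k)).B4 := by
    rw [problem_B4, hr 11 (by norm_num), f5, f6, ← hr2, ← hr3]
    simp [assigned, sq]
  have g12 : s'.real 12 = (G.problem (Finset.Iic k)).B5 := by
    change _ = 8 * G.xb * (G.xa + G.xb) * (G.problem (Finset.Iic k)).vaK
        * (G.problem (Finset.Iic k)).vbKc
      - 2 * G.xa ^ 2 * (G.problem (Finset.Iic k)).vaK * (G.problem (Finset.Iic k)).vbK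
    rw [hr 12 (by norm_num), f4, f5, f6, ← hr2, ← hr3]
    simp [assigned, sq]
  have g13 : s'.real 13 = (G.problem (Finset.Iic k)).B6 := by
    change _ = G.xa ^ 2 * (G.problem (Finset.Iic k)).vaK ^ 2
      - 4 * G.xb * (G.xa + G.xb) * (G.problem (Finset.Iic k)).cK
        * (G.problem (Finset.Iic k)).vbKc
    rw [hr 13 (by norm_num), f4, f6, f7, ← hr2, ← hr3]
    simp [assigned, sq]
  have k0 : s''.real 0 = (G.problem (Finset.Iic k)).lo := by
    change _ = (-(G.problem (Finset.Iic k)).B5 - √((G.problem (Finset.Iic k)).B5 ^ 2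
      - 4 * (G.problem (Finset.Iic k)).B4 * (G.problem (Finset.Iic k)).B6)) /
        (2 * (G.problem (Finset.Iic k)).B4)
    rw [hr' 0 (by norm_num), ← g11, ← g12, ← g13]
    simp [assigned, sq]
  have k1 : s''.real 1 = (G.problem (Finset.Iic k)).hi := by
    change _ = (-(G.problem (Finset.Iic k)).B5 + √((G.problem (Finset.Iic k)).B5 ^ 2
      - 4 * (G.problem (Finset.Iic k)).B4 * (G.problem (Finset.Iic k)).B6)) /
        (2 * (G.problem (Finset.Iic k)).B4)
    rw [hr' 1 (by norm_num), ← g11, ← g12, ← g13]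
    simp [assigned, sq]
  have kk : ∀ r, 2 ≤ r → r ≤ 13 → s''.real r = s'.real r := by
    intro r h2 h7
    rw [hr' r (by omega), assigned_real_of_ne _ (by simp; omega)]
  have q : ∀ r, 16 ≤ r → r ≤ 19 → r ≠ 18 → s''.real r = s.real r := by
    intro r h2 h7 h18
    rw [hr' r (by omega), assigned_real_of_ne _ (by simp; omega), hr r (by omega),
      assigned_real_of_ne _ (by simp; omega)]
  refine ⟨⟨⟨?_, ?_, ?_, ?_, ?_⟩, ?_⟩, ?_, ?_, ?_, ?_⟩
  · rw [e1', assigned_nat, e1, assigned_nat, h1]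
  · rw [e1', assigned_nat, e1, assigned_nat, h3]
  · rw [e2', assigned_arr, e2, assigned_arr, ha]
  · rw [e2', assigned_arr, e2, assigned_arr, hb]
  · rw [q 19 (by norm_num) (by norm_num) (by norm_num), h19]
  · intro i
    change Fin 14 at i
    fin_cases i
    · exact k0
    · exact k1
    · exact (kk 2 (by norm_num) (by norm_num)).trans ((g 2 (by norm_num) (by norm_num)).trans hr2)
    · exact (kk 3 (by norm_num) (by norm_num)).trans ((g 3 (by norm_num) (by norm_num)).trans hr3)
    · exact (kk 4 (by norm_num) (by norm_num)).trans
        ((g 4 (by norm_num) (by norm_num)).trans f4.symm)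
    · exact (kk 5 (by norm_num) (by norm_num)).trans
        ((g 5 (by norm_num) (by norm_num)).trans f5.symm)
    · exact (kk 6 (by norm_num) (by norm_num)).trans
        ((g 6 (by norm_num) (by norm_num)).trans f6.symm)
    · exact (kk 7 (by norm_num) (by norm_num)).trans
        ((g 7 (by norm_num) (by norm_num)).trans f7.symm)
    · exact (kk 8 (by norm_num) (by norm_num)).trans g8
    · exact (kk 9 (by norm_num) (by norm_num)).trans g9
    · exact (kk 10 (by norm_num) (by norm_num)).trans g10
    · exact (kk 11 (by norm_num) (by norm_num)).trans g11
    · exact (kk 12 (by norm_num) (by norm_num)).trans g12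
    · exact (kk 13 (by norm_num) (by norm_num)).trans g13
  · rw [e1', assigned_nat, e1, assigned_nat, h0]
  · rw [hr' 18 (by norm_num)]
    simp [assigned]
  · rw [q 16 (by norm_num) (by norm_num) (by norm_num), hr16]
  · rw [q 17 (by norm_num) (by norm_num) (by norm_num), hr17]

lemma runs_formulateKind (hn : 0 < n) (hG : G.Sorted) (k : Fin n) (α : ℝ) {s : RamState}
    (hs : G.HoldsCoeffs k α s) (h0 : s.nat 0 = n) (h18 : s.real 18 = 0)
    (h16 : s.real 16 = G.arrA (k + 1 - 1) / G.arrB (k + 1 - 1))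
    (h17 : s.real 17 = G.arrA 0 / G.arrB 0) :
    Runs n formulateKind s fun s => G.HoldsCoeffs k α s ∧
      s.nat 0 = (G.problem (Finset.Iic k)).kind.code := by
  have hset : ∀ c, (G.problem (Finset.Iic k)).kind.code = c →
      Runs n (.instr (.natConst 0 c)) s fun s => G.HoldsCoeffs k α s ∧
        s.nat 0 = (G.problem (Finset.Iic k)).kind.code := by
    intro c hc
    refine Runs.instr hn ⟨⟨⟨?_, ?_, ?_, ?_, ?_⟩, ?_⟩, ?_⟩
    · simpa [Instr.apply] using hs.1.1
    · simpa [Instr.apply] using hs.1.2.1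
    · exact hs.1.2.2.1
    · exact hs.1.2.2.2.1
    · exact hs.1.2.2.2.2
    · exact hs.2
    · simp [Instr.apply, hc]
  have h11 : s.real 11 = (G.problem (Finset.Iic k)).B4 := hs.2 (11 : Fin 14)
  have hk : (G.problem (Finset.Iic k)).kind =
    G.problemKind (Finset.Iic k) (G.problem (Finset.Iic k)).B4 := rfl
  have t1 : Test.Holds (.realLe 16 17) s ↔ G.UniformOn (Finset.Iic k) := by
    rw [uniformOn_Iic_iff hG, Test.Holds, h16, h17]
  have t2 : Test.Holds (.realLe 18 11) s ↔ 0 ≤ (G.problem (Finset.Iic k)).B4 := by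
    rw [Test.Holds, h18, h11]
  have t3 : Test.Holds (.realLe 11 18) s ↔ (G.problem (Finset.Iic k)).B4 ≤ 0 := by
    rw [Test.Holds, h18, h11]
  have t4 : Test.Holds (.natLt 1 0) s ↔ ¬ Finset.Iic k = Finset.univ := by
    rw [Iic_eq_univ_iff, not_not, Test.Holds, h0, hs.1.1]
  unfold problemKind at hk
  refine Runs.ite hn (fun a1 => Runs.ite hn (fun a2 => hset _ ?_) fun a2 => hset _ ?_)
    fun a1 => Runs.ite hn (fun a2 => hset _ ?_) fun a2 => Runs.ite hn (fun a3 => hset _ ?_)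
      fun a3 => hset _ ?_
  · rw [hk, if_pos (t1.1 a1), if_pos (t2.1 a2), Kind.code]
  · rw [hk, if_pos (t1.1 a1), if_neg (mt t2.2 a2), Kind.code]
  · rw [hk, if_neg (mt t1.2 a1), if_pos (t3.1 a2), Kind.code]
  · rw [hk, if_neg (mt t1.2 a1), if_neg (mt t3.2 a2), if_neg (t4.1 a3), Kind.code]
  · rw [hk, if_neg (mt t1.2 a1), if_neg (mt t3.2 a2), if_pos (not_not.1 (mt t4.2 a3)), Kind.code]

lemma runs_formulate (hn : 0 < n) (hG : G.Sorted) (k : Fin n) (α : ℝ) :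
    Runs n formulate (G.input (k + 1) α) fun s => G.HoldsCoeffs k α s ∧
      s.nat 0 = (G.problem (Finset.Iic k)).kind.code :=
  Runs.seq ((runs_formulateInit hn k α).mono fun _ h1 =>
    Runs.seq ((runs_formulateSums hn k α h1.1 h1.2).mono fun _ h2 =>
      Runs.seq ((runs_formulateCoeffs hn k α h2).mono fun _ h3 =>
        runs_formulateKind hn hG k α h3.1 h3.2.1 h3.2.2.1 h3.2.2.2.1 h3.2.2.2.2)))

end Game

/-! ### The recovery program -/

section Programs

open RExpr Prog Instr

/-- Computes, from the kind of the problem, real registers `0` and `1` such that in every case the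
investment in a battlefield of `K` is
`real 0 * va j + real 1 * (va j / √(vb j) - α * √(vb j)) ^ 2`. -/
def recoverFactors : Prog :=
  .seq (.instr (natConst 4 2)) (.ite (.natLt 0 4)
    (assign
      [(0, (reg 2 * reg 5 - const 2 * reg 3 * reg 6 +
          sqrt (reg 2 * reg 2 * (reg 5 * reg 5) - const 4 * reg 2 * reg 3 * reg 5 * reg 6
            - const 4 * (reg 3 * reg 3) * reg 5 * reg 6)) /
          (const 2 * (reg 6 + reg 5)) / reg 4),
       (1, const 0)])
    (.seq (.instr (natConst 4 3)) (.ite (.natLt 0 4)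
      (assign
        [(0, const 0),
         (1, reg 2 / (reg 7 - const 2 * reg 19 * reg 4 + reg 19 * reg 19 * reg 5))])
      (assign
        [(0, const 0),
         (1, const 2 * (reg 3 * reg 3) * reg 6 /
          (reg 8 * (reg 19 * reg 19) + reg 9 * reg 19 + reg 10 -
            (reg 4 - reg 5 * reg 19) *
              sqrt (reg 11 * (reg 19 * reg 19) + reg 12 * reg 19 + reg 13)))]))))

/-- One step of the loop over `K`: stores the investment and adds it up. -/
def recoverInside : Prog :=
  .seq (assign
    [(14, entry 0 2), (15, entry 1 2),
     (16, reg 14 / sqrt (reg 15) - reg 19 * sqrt (reg 15)),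
     (17, reg 0 * reg 14 + reg 1 * (reg 16 * reg 16)),
     (8, reg 8 + reg 17), (9, reg 9 + sqrt (reg 17 * reg 15))])
    (.seq (.instr (store 2 2 17)) (.instr (natSucc 2)))

/-- One step of the loop over the complement of `K`. -/
def recoverOutside : Prog :=
  .seq (assign [(17, entry 1 2 * ((reg 3 + reg 8) * (reg 3 + reg 8)) / (reg 9 * reg 9))])
    (.seq (.instr (store 2 2 17)) (.instr (natSucc 2)))

/-- Stores the commitment in array `2`; the real registers `8` and `9` accumulate the sums in the
formula for the investments outside of `K`. -/
def recoverLoops : Prog :=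
  .seq (.instr (natConst 2 0)) (.seq (assign [(8, const 0), (9, const 0)])
    (.seq (.loop (.natLt 2 1) recoverInside) (.loop (.natLt 2 3) recoverOutside)))

/-- The program that computes the commitment that belongs to a parameter. -/
def recover : Prog := .seq formulate (.seq recoverFactors recoverLoops)

end Programs

namespace Game

variable {n : ℕ} {G : Game n}

lemma runs_recoverFactors (hn : 0 < n) (k : Fin n) {α : ℝ}
    (hk : (G.problem (Finset.Iic k)).kind ≠ .infeasible) {s : RamState}
    (hs : G.HoldsCoeffs k α s) (h0 : s.nat 0 = (G.problem (Finset.Iic k)).kind.code) :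
    Runs n recoverFactors s fun s => G.Fixed k α s ∧ s.real 3 = G.xb ∧
      ∀ j, G.insideInvestment (Finset.Iic k) α j = s.real 0 * G.va j +
        s.real 1 * (G.va j / √(G.vb j) - α * √(G.vb j)) ^ 2 := by
  obtain ⟨⟨h1, h3, ha, hb, h19⟩, hc⟩ := hs
  have r2 : s.real 2 = (G.problem (Finset.Iic k)).xa := hc (2 : Fin 14)
  have r3 : s.real 3 = (G.problem (Finset.Iic k)).xb := hc (3 : Fin 14)
  have r4 : s.real 4 = (G.problem (Finset.Iic k)).vaK := hc (4 : Fin 14)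
  have r5 : s.real 5 = (G.problem (Finset.Iic k)).vbK := hc (5 : Fin 14)
  have r6 : s.real 6 = (G.problem (Finset.Iic k)).vbKc := hc (6 : Fin 14)
  have r7 : s.real 7 = (G.problem (Finset.Iic k)).cK := hc (7 : Fin 14)
  have r8 : s.real 8 = (G.problem (Finset.Iic k)).B1 := hc (8 : Fin 14)
  have r9 : s.real 9 = (G.problem (Finset.Iic k)).B2 := hc (9 : Fin 14)
  have r10 : s.real 10 = (G.problem (Finset.Iic k)).B3 := hc (10 : Fin 14)
  have r11 : s.real 11 = (G.problem (Finset.Iic k)).B4 := hc (11 : Fin 14)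
  have r12 : s.real 12 = (G.problem (Finset.Iic k)).B5 := hc (12 : Fin 14)
  have r13 : s.real 13 = (G.problem (Finset.Iic k)).B6 := hc (13 : Fin 14)
  -- the assignments in each branch only concern the first two registers
  have finish : ∀ (l : List (ℕ × RExpr)) (s₁ : RamState), AssignBelow l →
      (∀ r, 2 ≤ r → ∀ a ∈ l, a.1 ≠ r) → s₁.nat 1 = s.nat 1 → s₁.nat 3 = s.nat 3 →
      s₁.arr = s.arr → s₁.real = s.real →
      (∀ j, G.insideInvestment (Finset.Iic k) α j = (assigned l s₁).real 0 * G.va j +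
        (assigned l s₁).real 1 * (G.va j / √(G.vb j) - α * √(G.vb j)) ^ 2) →
      Runs n (assign l) s₁ fun s => G.Fixed k α s ∧ s.real 3 = G.xb ∧
      ∀ j, G.insideInvestment (Finset.Iic k) α j = s.real 0 * G.va j +
        s.real 1 * (G.va j / √(G.vb j) - α * √(G.vb j)) ^ 2 := by
    intro l s₁ hl ht hn1 hn3 harr hreal hj
    refine runs_assign hn hl fun s' ⟨e1, e2, e3⟩ => ?_
    have hr : ∀ r < 20, s'.real r = _ := e3
    refine ⟨⟨?_, ?_, ?_, ?_, ?_⟩, ?_, fun j => ?_⟩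
    · rw [e1, assigned_nat, hn1, h1]
    · rw [e1, assigned_nat, hn3, h3]
    · rw [e2, assigned_arr, harr, ha]
    · rw [e2, assigned_arr, harr, hb]
    · rw [hr 19 (by norm_num), assigned_real_of_ne _ (ht 19 (by norm_num)), hreal, h19]
    · rw [hr 3 (by norm_num), assigned_real_of_ne _ (ht 3 (by norm_num)), hreal, r3]
      rfl
    · rw [hj, hr 0 (by norm_num), hr 1 (by norm_num)]
  refine Runs.seq (Runs.instr hn (Runs.ite hn (fun a1 => ?_)
    fun a1 => Runs.seq (Runs.instr hn (Runs.ite hn (fun a2 => ?_) fun a2 => ?_))))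
  · have hu : (G.problem (Finset.Iic k)).kind = .uniform := by
      simp only [Test.Holds, Instr.apply] at a1
      simp [h0] at a1
      revert a1 hk
      cases (G.problem (Finset.Iic k)).kind <;> simp [Kind.code]
    refine finish _ _ (by decide) (by simp; omega) (by simp [Instr.apply])
      (by simp [Instr.apply]) rfl rfl fun j => ?_
    unfold insideInvestment
    simp only [hu]
    simp only [assigned, RExpr.eval_reg, RExpr.eval_const, RExpr.eval_add, RExpr.eval_sub,
      RExpr.eval_mul, RExpr.eval_div, RExpr.eval_sqrt, Instr.apply]
    simp [UniProblem.uniformBudget, r2, r3, r4, r5, r6, sq]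
    ring
  · have hf : (G.problem (Finset.Iic k)).kind = .full := by
      simp only [Test.Holds, Instr.apply] at a1 a2
      simp [h0] at a1 a2
      revert a1 a2 hk
      cases (G.problem (Finset.Iic k)).kind <;> simp [Kind.code]
    refine finish _ _ (by decide) (by simp; omega) (by simp [Instr.apply])
      (by simp [Instr.apply]) rfl rfl fun j => ?_
    have hA : ∑ l, (G.va l / √(G.vb l) - α * √(G.vb l)) ^ 2 =
        (G.problem (Finset.Iic k)).A1 α := by
      rw [problem_A1, (univ_of_kind_eq_full hf).2.2]
      exact Finset.sum_congr rfl fun j _ => sq_div_sqrt_sub j α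
    have hxa : G.xa = (G.problem (Finset.Iic k)).xa := rfl
    unfold insideInvestment
    simp only [hf]
    rw [hA, UniProblem.A1, hxa]
    simp [assigned, Instr.apply, r2, r4, r5, r7, h19, sq]
    ring
  · have hp : (G.problem (Finset.Iic k)).kind = .proper := by
      simp only [Test.Holds, Instr.apply] at a1 a2
      simp [h0] at a1 a2
      revert a1 a2 hk
      cases (G.problem (Finset.Iic k)).kind <;> simp [Kind.code]
    refine finish _ _ (by decide) (by simp; omega) (by simp [Instr.apply])
      (by simp [Instr.apply]) rfl rfl fun j => ?_
    have hxb : G.xb = (G.problem (Finset.Iic k)).xb := rfl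
    unfold insideInvestment
    simp only [hp]
    rw [hxb, UniProblem.phi1, UniProblem.phi2]
    simp [assigned, Instr.apply, r3, r4, r5, r6, r8, r9, r10, r11, r12, r13, h19, sq]
    ring

lemma runs_recoverLoops (hn : 0 < n) (k : Fin n) {α c₁ c₂ : ℝ} {s : RamState}
    (hs : G.Fixed k α s) (h3 : s.real 3 = G.xb) (hc₁ : s.real 0 = c₁) (hc₂ : s.real 1 = c₂)
    (hin : ∀ j, G.insideInvestment (Finset.Iic k) α j = c₁ * G.va j +
        c₂ * (G.va j / √(G.vb j) - α * √(G.vb j)) ^ 2) :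
    Runs n recoverLoops s fun s => s.HoldsVector (G.commitment (Finset.Iic k) α) := by
  set g : ℕ → ℝ := fun i => c₁ * G.arrA i +
    c₂ * (G.arrA i / √(G.arrB i) - α * √(G.arrB i)) ^ 2 with hg
  have hgj : ∀ j : Fin n, g j = G.insideInvestment (Finset.Iic k) α j := fun j => by
    rw [hin, hg]
    simp only [arrA_val, arrB_val]
  set X := ∑ j ∈ Finset.Iic k, G.insideInvestment (Finset.Iic k) α j with hX
  set S := ∑ j ∈ Finset.Iic k, √(G.insideInvestment (Finset.Iic k) α j * G.vb j) with hS
  have hXg : X = ∑ i ∈ Finset.range (k + 1), g i := sum_Iic_eq k hgj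
  have hSg : S = ∑ i ∈ Finset.range (k + 1), √(g i * G.arrB i) :=
    sum_Iic_eq k fun j => by rw [hgj, arrB_val]
  set h : ℕ → ℝ := fun i => G.arrB i * (G.xb + X) ^ 2 / S ^ 2 with hh
  let I : ℕ → RamState → Prop := fun i s => G.Fixed k α s ∧ s.real 3 = G.xb ∧
    s.real 0 = c₁ ∧ s.real 1 = c₂ ∧ s.real 8 = ∑ l ∈ Finset.range i, g l ∧
    s.real 9 = ∑ l ∈ Finset.range i, √(g l * G.arrB l) ∧ s.nat 2 = i ∧
    ∀ l < i, s.arr 2 l = g l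
  let J : ℕ → RamState → Prop := fun i s => G.Fixed k α s ∧ s.real 3 = G.xb ∧
    s.real 8 = X ∧ s.real 9 = S ∧ s.nat 2 = k + 1 + i ∧
    (∀ l < (k : ℕ) + 1, s.arr 2 l = g l) ∧
    ∀ l, (k : ℕ) + 1 ≤ l → l < k + 1 + i → s.arr 2 l = h l
  obtain ⟨f1, f3, fa, fb, f19⟩ := hs
  refine Runs.seq (Runs.instr hn (Runs.seq (runs_assign hn (by decide)
    fun s' ⟨e1, e2, e3⟩ => Runs.seq ?_)))
  have hr : ∀ r < 20, s'.real r = _ := e3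
  have hI : I 0 s' := by
    refine ⟨⟨?_, ?_, ?_, ?_, ?_⟩, ?_, ?_, ?_, ?_, ?_, ?_, ?_⟩
    all_goals first
      | rw [hr _ (by norm_num)]
      | rw [e1]
      | rw [e2]
    all_goals simp [assigned, Instr.apply, *]
  refine (Runs.loop (N := k + 1) k.2 hn I ?_ ?_ hI).mono ?_
  · rintro i hi s ⟨⟨f1, f3, fa, fb, f19⟩, i3, i0, i1, i8, i9, i2, iarr⟩
    refine ⟨by simpa [Test.Holds, f1, i2] using hi, Runs.seq (runs_assign one_pos (by decide)
      fun s' ⟨e1, e2, e3⟩ => Runs.seq (Runs.instr one_pos (Runs.instr one_pos ?_)))⟩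
    have hr : ∀ r < 20, s'.real r = _ := e3
    rw [assigned_nat] at e1
    rw [assigned_arr] at e2
    have hr17 : s'.real 17 = g i := by
      rw [hr 17 (by norm_num)]
      simp [assigned, i0, i1, fa, fb, i2, f19, hg, sq]
    refine ⟨⟨?_, ?_, ?_, ?_, ?_⟩, ?_, ?_, ?_, ?_, ?_, ?_, ?_⟩
    · simpa [Instr.apply, e1] using f1
    · simpa [Instr.apply, e1] using f3
    · simpa [Instr.apply, e2] using fa
    · simpa [Instr.apply, e2] using fb
    · simp only [Instr.apply]
      rw [hr 19 (by norm_num), assigned_real_of_ne _ (by simp), f19]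
    · simp only [Instr.apply]
      rw [hr 3 (by norm_num), assigned_real_of_ne _ (by simp), i3]
    · simp only [Instr.apply]
      rw [hr 0 (by norm_num), assigned_real_of_ne _ (by simp), i0]
    · simp only [Instr.apply]
      rw [hr 1 (by norm_num), assigned_real_of_ne _ (by simp), i1]
    · simp only [Instr.apply]
      rw [hr 8 (by norm_num), Finset.sum_range_succ]
      simp [assigned, i0, i1, fa, fb, i2, f19, hg, sq, i8]
    · simp only [Instr.apply]
      rw [hr 9 (by norm_num), Finset.sum_range_succ]
      simp [assigned, i0, i1, fa, fb, i2, f19, hg, sq, i9]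
    · simp [Instr.apply, e1, i2]
    · intro l hl
      rcases Nat.lt_succ_iff_lt_or_eq.1 hl with hl | rfl
      · simp [Instr.apply, e1, e2, i2, hl.ne, iarr l hl]
      · simp [Instr.apply, e1, i2, hr17]
  · rintro s ⟨⟨f1, -⟩, -, -, -, -, -, i2, -⟩
    simp [Test.Holds, f1, i2]
  · rintro s ⟨hs, i3, i0, i1, i8, i9, i2, iarr⟩
    have hJ : J 0 s := ⟨hs, i3, i8.trans hXg.symm, i9.trans hSg.symm, i2, iarr,
      fun l h1 h2 => absurd h2 (by omega)⟩
    refine (Runs.loop (N := n - (k + 1)) (Nat.sub_le _ _) hn J ?_ ?_ hJ).mono ?_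
    · rintro i hi s ⟨⟨f1, f3, fa, fb, f19⟩, j3, j8, j9, j2, jin, jout⟩
      refine ⟨by simp only [Test.Holds, f3, j2]; omega, Runs.seq (runs_assign one_pos (by decide)
        fun s' ⟨e1, e2, e3⟩ => Runs.seq (Runs.instr one_pos (Runs.instr one_pos ?_)))⟩
      have hr : ∀ r < 20, s'.real r = _ := e3
      rw [assigned_nat] at e1
      rw [assigned_arr] at e2
      have hr17 : s'.real 17 = h (k + 1 + i) := by
        rw [hr 17 (by norm_num)]
        simp [assigned, j3, j8, j9, fb, j2, hh, sq]
      refine ⟨⟨?_, ?_, ?_, ?_, ?_⟩, ?_, ?_, ?_, ?_, ?_, ?_⟩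
      · simpa [Instr.apply, e1] using f1
      · simpa [Instr.apply, e1] using f3
      · simpa [Instr.apply, e2] using fa
      · simpa [Instr.apply, e2] using fb
      · simp only [Instr.apply]
        rw [hr 19 (by norm_num), assigned_real_of_ne _ (by simp), f19]
      · simp only [Instr.apply]
        rw [hr 3 (by norm_num), assigned_real_of_ne _ (by simp), j3]
      · simp only [Instr.apply]
        rw [hr 8 (by norm_num), assigned_real_of_ne _ (by simp), j8]
      · simp only [Instr.apply]
        rw [hr 9 (by norm_num), assigned_real_of_ne _ (by simp), j9]
      · simp [Instr.apply, e1, j2, add_assoc]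
      · intro l hl
        have : l ≠ k + 1 + i := by omega
        simp [Instr.apply, e1, e2, j2, this, jin l hl]
      · intro l hl hl'
        by_cases hli : l = k + 1 + i
        · subst hli
          simp [Instr.apply, e1, j2, hr17]
        · simp [Instr.apply, e1, e2, j2, hli, jout l hl (by omega)]
    · rintro s ⟨⟨f1, f3, -⟩, -, -, -, j2, -⟩
      simp only [Test.Holds, f3, j2]
      omega
    · rintro s ⟨-, -, -, -, -, jin, jout⟩ j
      unfold commitment
      split_ifs with hj
      · rw [Finset.mem_Iic, Fin.le_def] at hj
        rw [jin j (by omega), hgj]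
      · rw [Finset.mem_Iic, Fin.le_def] at hj
        rw [jout j (by omega) (by have := j.2; omega), hh, hX, hS]
        simp only [arrB_val]

lemma runs_recover (hn : 0 < n) (hG : G.Sorted) (k : Fin n) {α : ℝ}
    (hk : (G.problem (Finset.Iic k)).kind ≠ .infeasible) :
    Runs n recover (G.input (k + 1) α)
      fun s => s.HoldsVector (G.commitment (Finset.Iic k) α) :=
  Runs.seq ((runs_formulate hn hG k α).mono fun _ h1 =>
    Runs.seq ((runs_recoverFactors hn k hk h1.1 h1.2).mono fun _ h2 =>
      runs_recoverLoops hn k h2.1 h2.2.1 rfl rfl h2.2.2))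

end Game

theorem theorem2 :
    -- a formulation program, a recovery program and a time constant, the same for all games
    ∃ (F R : Prog) (C : ℕ), ∀ (n : ℕ) (_ : 0 < n) (G : Game n), G.Sorted →
      -- the supports are the initial segments `K = Finset.Iic k` of the battlefields
      (∀ k : Fin n,
        -- the univariate problem is formulated in `O(n)` steps
        (∃ m ≤ C * n, ∃ s, Exec F (G.input (k + 1) 0) m s ∧
          s.Encodes (G.problem (Finset.Iic k))) ∧
        -- the commitment that belongs to a given `α` is computed in `O(n)` steps
        (∀ α ∈ (G.problem (Finset.Iic k)).domain,
          ∃ m ≤ C * n, ∃ s, Exec R (G.input (k + 1) α) m s ∧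
            s.HoldsVector (G.commitment (Finset.Iic k) α)) ∧
        -- the shape of the univariate problem, and its equivalence with the leader's problem for `K`
        ((G.problem (Finset.Iic k)).kind ≠ Kind.infeasible →
          (G.problem (Finset.Iic k)).lo ≤ (G.problem (Finset.Iic k)).hi ∧
          (G.problem (Finset.Iic k)).domain =
            Set.Iic (G.problem (Finset.Iic k)).lo ∪ Set.Ici (G.problem (Finset.Iic k)).hi ∧
          ContinuousOn (G.problem (Finset.Iic k)).objective (G.problem (Finset.Iic k)).domain ∧
          (G.problem (Finset.Iic k)).solutions.Nonempty ∧
          (∀ x, G.SolvesSupport (Finset.Iic k) x ↔ x ∈ G.candidates (Finset.Iic k)) ∧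
          ∀ α ∈ (G.problem (Finset.Iic k)).solutions,
            (G.problem (Finset.Iic k)).objective α =
              G.hatU (Finset.Iic k) (G.commitment (Finset.Iic k) α)) ∧
        -- the closed form for unequal value ratios and `K = [n]`
        ((G.problem (Finset.Iic k)).kind = Kind.full →
          (G.problem (Finset.Iic k)).solutions =
            {-√((∑ h, G.va h ^ 2 / G.vb h) / ∑ h, G.vb h)} ∧
          G.candidates (Finset.Iic k) =
            {fun j =>
              (G.va j / √(G.vb j) +
                  √((∑ h, G.va h ^ 2 / G.vb h) / ∑ h, G.vb h) * √(G.vb j)) ^ 2 /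
                (∑ l, (G.va l / √(G.vb l) +
                  √((∑ h, G.va h ^ 2 / G.vb h) / ∑ h, G.vb h) * √(G.vb l)) ^ 2) * G.xa}) ∧
        -- the solution represents the optimal commitment if the follower's support is `K`
        (∀ x y, G.IsOptimalCommitment x → G.IsBestResponse x y →
          (∀ j, 0 < y j ↔ j ∈ Finset.Iic k) →
          (G.problem (Finset.Iic k)).kind ≠ Kind.infeasible ∧
          ∀ α ∈ (G.problem (Finset.Iic k)).solutions,
            x = G.commitment (Finset.Iic k) α ∧
            G.leaderUtility x y =
              (G.problem (Finset.Iic k)).objective α + ∑ j ∈ (Finset.Iic k)ᶜ, G.va j)) ∧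
      -- an optimal commitment exists, and the follower's support is one of the sets `K`
      (∃ x, G.IsOptimalCommitment x) ∧
      (∀ x y, G.IsOptimalCommitment x → G.IsBestResponse x y →
        ∃ k : Fin n, ∀ j, 0 < y j ↔ j ∈ Finset.Iic k) ∧
      -- the optimal commitments are the best ones among the candidates
      (∀ x, G.IsOptimalCommitment x ↔
        (∃ k : Fin n, x ∈ G.candidates (Finset.Iic k)) ∧
        ∃ y, G.IsBestResponse x y ∧
          ∀ (k' : Fin n) (x' y' : Fin n → ℝ), x' ∈ G.candidates (Finset.Iic k') →
            G.IsBestResponse x' y' → G.leaderUtility x' y' ≤ G.leaderUtility x y) := by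
  refine ⟨formulate, recover, max formulate.cost recover.cost, fun n hn G hG => ?_⟩
  have : NeZero n := ⟨hn.ne'⟩
  have hKn : ∀ k : Fin n, (Finset.Iic k).Nonempty := fun k => ⟨k, Finset.mem_Iic.2 le_rfl⟩
  refine ⟨fun k => ⟨?_, fun α hα => ?_, fun hk => ?_, fun hk => Game.full_closed_form hk,
    fun x y hx hy hK => ?_⟩, Game.exists_isOptimalCommitment,
    fun x y hx hy => hx.exists_support hG hy,
    fun x => Game.isOptimalCommitment_iff_candidates hG x⟩
  · obtain ⟨m, hm, s, he, hs, h0⟩ := Game.runs_formulate hn hG k 0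
    exact ⟨m, hm.trans (Nat.mul_le_mul_right n (le_max_left _ _)), s, he, h0, hs.2⟩
  · obtain ⟨m, hm, s, he, hs⟩ := Game.runs_recover hn hG k (α := α) hα.1
    exact ⟨m, hm.trans (Nat.mul_le_mul_right n (le_max_right _ _)), s, he, hs⟩
  · have hB := Game.B4_nonneg_of_kind hk
    obtain ⟨h1, h2⟩ := Game.lo_le_hi_and_domain_eq (hKn k) hk
    refine ⟨h1, h2, Game.continuousOn_objective hk, Game.solutions_nonempty (hKn k) hk,
      fun x => ?_, fun α hα => Game.hatU_commitment (hKn k) hk hα⟩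
    rw [Game.solvesSupport_iff (hKn k) hB, Game.candidates_eq (hKn k) hk, Set.mem_singleton_iff]
  · obtain ⟨hk, hx', hU⟩ := hx.eq_investment (hKn k) hy hK
    refine ⟨hk, fun α hα => ?_⟩
    obtain ⟨h1, h2⟩ := Game.commitment_of_mem_solutions (hKn k) hk hα
    rw [h1, h2]
    exact ⟨hx', hU⟩
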